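/- Let $a$ be an irreducible representation of the canonical commutation relation on a non-zero complex Hilbert space $\mathcal H$: $a$ is closed and densely defined, $aa^*=a^*a+1$ as an equality of operators with their natural domains, and no closed subspace other than $0$ and $\mathcal H$ reduces $a$. Let $\omega\ge 0$, $\alpha\in\mathbb C$, and let $H=\omega a^*a+\tfrac{\alpha}{2}a^2+\tfrac{\bar\alpha}{2}{a^*}^2$ on its natural domain. For $z\in\mathbb C$ let $[\psi(z)]$ be the space of solutions $\psi\in D(a)\cap D(a^*)$ of $(a+za^*)\psi=0$; a squeezed state is a non-zero such solution. Let $D=\{|z|<1\}$ carry the hyperbolic distance $d(z,w)=\ln\frac{|\bar zw-1|+|z-w|}{|\bar zw-1|-|z-w|}$. Then $[\psi(z)]$ is a complex line if $|z|<1$ and is $0$ if $|z|\ge1$, and $z\mapsto[\psi(z)]$ is one-to-one on $D$. There is a unique strongly continuous one-parameter unitary group $U(t)=e^{-itH}$ with $\frac{d}{dt}U(t)\varphi|_{t=0}=-iH\varphi$ for all $\varphi$ in the domain of $H$. There are maps $M(t):D\to D$ with $U(t)[\psi(z)]=[\psi(M(t)z)]$ for all $t\in\mathbb R$, $z\in D$;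 they form a continuous one-parameter group of Möbius transformations $z\mapsto\frac{uz+v}{\bar vz+\bar u}$, $|u|>|v|$, of $D$. Put $\lambda=\sqrt{\omega^2-|\alpha|^2}$ (with $\lambda=i\sqrt{|\alpha|^2-\omega^2}$ if $\omega<|\alpha|$) and $\xi_\pm=(\omega\pm\lambda)/\alpha$ (and $\xi_-=0$ if $\alpha=0<\omega$). For $z\in D$ let $C=\{M(t)z: t\in\mathbb R\}$. (i) Stable case $\omega>|\alpha|$: $\xi_-\in D$, and $C$ is the hyperbolic circle with center $\xi_-$ through $z$ (the point $\xi_-$ if $z=\xi_-$); if $z\ne\xi_-$, it is traversed clockwise. (ii) Free case $\omega=|\alpha|>0$: $\xi_-=\xi_+$ lies on the unit circle, and $C$ is a horocycle at $\xi_\pm$, i.e. a Euclidean circle of radius less than $1$ that touches the unit circle from inside at $\xi_\pm$, without the point $\xi_\pm$; it is traversed clockwise. (iii) Unstable case $\omega<|\alpha|$: $\xi_-\neq\xi_+$ lie on the unit circle, and $C$ is a hypercycle with end points $\xi_\pm$, i.e. the part inside $D$ of a Euclidean circle or straight line that meets the unit circle exactly in $\xi_-$ and $\xi_+$ (the hyperbolic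 line between them included). The map $t\mapsto M(t)z$ is injective, and $M(t)z\to\xi_\pm$ as $t\to\pm\infty$. -/

import Mathlib

open scoped ComplexConjugate Topology InnerProductSpace Complex.UnitDisc
open Filter

noncomputable section

namespace Squeezed

section Operators

variable {H : Type*} [NormedAddCommGroup H] [InnerProductSpace ℂ H]

/-- The product `S T` of two partially defined operators, with its natural domain
`{x ∈ D(T) | T x ∈ D(S)}`. -/
def opMul (S T : H →ₗ.[ℂ] H) : H →ₗ.[ℂ] H where
  domain := (S.domain.comap T.toFun).map T.domain.subtype
  toFun :=
    { toFun := fun x =>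
        S ⟨T ⟨(x : H), by obtain ⟨_, y, _, rfl⟩ := x; exact y.2⟩,
          by obtain ⟨_, y, hy, rfl⟩ := x; exact hy⟩
      map_add' := fun x y => by
        rw [← LinearPMap.map_add]
        congr 1
        apply Subtype.ext
        exact T.map_add ⟨(x : H), _⟩ ⟨(y : H), _⟩
      map_smul' := fun c x => by
        simp only [RingHom.id_apply]
        rw [← LinearPMap.map_smul]
        congr 1
        apply Subtype.ext
        exact T.map_smul c ⟨(x : H), _⟩ }

/-- The identity, as an everywhere defined operator. -/
def opOne : H →ₗ.[ℂ] H := LinearMap.toPMap LinearMap.id ⊤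

variable [CompleteSpace H]

/-- `a` and its Hilbert-space adjoint `a†` form an irreducible representation of the canonical
commutation relation `[a, a†] = 1`: `a` is closed and densely defined, `a a† = a† a + 1` as an
equality of operators with their natural domains, and no closed subspace other than `0` and the
whole space reduces `a` (a closed subspace `K` reduces `a` when the orthogonal projection `P` onto
`K` maps `D(a)` to `D(a)` and commutes with `a` there; `P` then also commutes with `a†`). -/
structure IsIrreducibleCCR (a : H →ₗ.[ℂ] H) : Prop where
  closed : a.IsClosed
  dense : Dense (a.domain : Set H)
  ccr : opMul a a.adjoint = opMul a.adjoint a + opOne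
  irreducible : ∀ (K : Submodule ℂ H) [K.HasOrthogonalProjection],
    (∀ x : a.domain, ∃ h : K.starProjection (x : H) ∈ a.domain,
      a ⟨K.starProjection (x : H), h⟩ = K.starProjection (a x)) → K = ⊥ ∨ K = ⊤

/-- The quadratic Hamiltonian `ω a†a + (α/2) a² + (ᾱ/2) a†²` on its natural domain
`D(a†a) ∩ D(a²) ∩ D(a†²)`. -/
def hamiltonian (a : H →ₗ.[ℂ] H) (ω : ℝ) (α : ℂ) : H →ₗ.[ℂ] H :=
  (ω : ℂ) • opMul a.adjoint a + (α / 2) • opMul a a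
    + (conj α / 2) • opMul a.adjoint a.adjoint

/-- `U` is an evolution `t ↦ e^{-itA}`: a strongly continuous one-parameter group of unitary
operators with `d/dt U(t) φ = -i A φ` at `t = 0`, for every `φ` in the domain of `A`. -/
structure IsEvolution (A : H →ₗ.[ℂ] H) (U : ℝ → H →L[ℂ] H) : Prop where
  unitary : ∀ t, U t ∈ unitary (H →L[ℂ] H)
  zero : U 0 = 1
  add : ∀ s t, U (s + t) = U s * U t
  continuous : ∀ φ : H, Continuous fun t => U t φ
  generator : ∀ φ : A.domain, HasDerivAt (fun t => U t (φ : H)) (-Complex.I • A φ) 0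

/-- `[ψ(z)]`: the space of all solutions `ψ ∈ D(a) ∩ D(a†)` of `(a + z a†) ψ = 0`. -/
def squeezedLine (a : H →ₗ.[ℂ] H) (z : ℂ) : Submodule ℂ H :=
  (LinearMap.ker (a + z • a.adjoint).toFun).map (a + z • a.adjoint).domain.subtype

end Operators

section Fixed

/-- `λ = √(ω² - |α|²)`; for `ω < |α|` this is `i √(|α|² - ω²)`. -/
def lam (ω : ℝ) (α : ℂ) : ℂ :=
  if ‖α‖ ≤ ω then (Real.sqrt (ω ^ 2 - ‖α‖ ^ 2) : ℂ)
  else Complex.I * (Real.sqrt (‖α‖ ^ 2 - ω ^ 2) : ℂ)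

/-- `ξ₊ = (ω + λ) / α` (meaningful for `α ≠ 0`). -/
def xiPlus (ω : ℝ) (α : ℂ) : ℂ := (ω + lam ω α) / α

/-- `ξ₋ = (ω - λ) / α`. For `α = 0 < ω` this is `0 / 0 = 0`, which is the right value: it is the
limit of `(ω - λ) / α = ᾱ / (ω + λ)` as `α → 0`. -/
def xiMinus (ω : ℝ) (α : ℂ) : ℂ := (ω - lam ω α) / α

end Fixed

section Geometry

/-- The hyperbolic distance of two points of the open unit disk. -/
def hdist (z w : ℂ) : ℝ :=
  Real.log ((‖conj z * w - 1‖ + ‖z - w‖) / (‖conj z * w - 1‖ - ‖z - w‖))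

/-- The hyperbolic circle with center `c` and hyperbolic radius `r` in the open unit disk
(for `r = 0` it is the point `c`). -/
def hypCircle (c : ℂ) (r : ℝ) : Set ℂ := {w | ‖w‖ < 1 ∧ hdist c w = r}

/-- For `|ξ| = 1` and `0 < r < 1`: the horocycle at `ξ` of Euclidean radius `r`, i.e. the Euclidean
circle of radius `r` that touches the unit circle from inside at `ξ`, without the point `ξ`. Its
Euclidean center is `(1 - r) ξ`. -/
def horocycle (ξ : ℂ) (r : ℝ) : Set ℂ := {w | ‖w - (1 - r) * ξ‖ = r ∧ w ≠ ξ}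

/-- Euclidean circles and straight lines in the plane. -/
def IsGeneralizedCircle (S : Set ℂ) : Prop :=
  (∃ c : ℂ, ∃ r : ℝ, 0 < r ∧ S = Metric.sphere c r) ∨
  (∃ p v : ℂ, v ≠ 0 ∧ S = Set.range fun t : ℝ => p + t * v)

/-- `C` is a hypercycle with the distinct ideal end points `p` and `q`: the part inside the open
unit disk of a Euclidean circle or line that meets the unit circle exactly in `p` and `q`
(the hyperbolic line from `p` to `q` is included, as the hypercycle of distance `0`). -/
def IsHypercycle (C : Set ℂ) (p q : ℂ) : Prop :=
  p ≠ q ∧ ∃ S : Set ℂ, IsGeneralizedCircle S ∧ S ∩ {w | ‖w‖ = 1} = {p, q} ∧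
    C = S ∩ {w | ‖w‖ < 1}

/-- The curve `γ` moves clockwise around `c`: at every time the derivative of the argument of
`γ - c` is negative. -/
def Clockwise (γ : ℝ → ℂ) (c : ℂ) : Prop :=
  ∀ t, ∃ v : ℂ, HasDerivAt γ v t ∧ (conj (γ t - c) * v).im < 0

/-- `M` is a (continuous) one-parameter group of Möbius transformations
`z ↦ (u z + v) / (v̄ z + ū)`, `|v| < |u|`, of the open unit disk. -/
structure IsMobiusFlow (M : ℝ → 𝔻 → 𝔻) : Prop where
  zero : ∀ z, M 0 z = z
  add : ∀ s t z, M (s + t) z = M s (M t z)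
  continuous : ∀ z, Continuous fun t => M t z
  mobius : ∀ t, ∃ u v : ℂ, ‖v‖ < ‖u‖ ∧
    ∀ z : 𝔻, (M t z : ℂ) = (u * z + v) / (conj v * z + conj u)

/-- The orbit of `z`. -/
def orbit (M : ℝ → 𝔻 → 𝔻) (z : 𝔻) : Set ℂ := Set.range fun t => (M t z : ℂ)

end Geometry

end Squeezed

end

/-!
The commutation relation forces the Fock representation. Since `1 + T†T` is surjective for every
closed `T`, the relation makes `a a† = a†a + 1` surjective, and if `a` had no kernel, an induction
would give `‖a x‖² ≥ n ‖x‖²` for all `n` (`IsIrreducibleCCR.le_norm_sq_of_injective`). So there is a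
vacuum, and `a†` generates from it an orthonormal ladder whose closed span reduces `a`. By
irreducibility the ladder is a basis in which `a` and `a†` are the maximal weighted shifts
(`IsIrreducibleCCR.exists_numberBasis`). The equation `(a + z a†) ψ = 0` becomes a two-term
recursion; its solutions are the multiples of `exp (-z a†² / 2) Ω` if `|z| < 1`, and for `|z| ≥ 1`
none of its non-zero formal solutions lies in `D(a†)`.

Write `ψ(z)` for this vector. Applying the Hamiltonian to `ψ(z)` or `a† ψ(z)` gives a combination of
that vector and its `z`-derivative. Hence a multiple of `ψ(ζ(t))`, and a multiple of `a† ψ(ζ(t))`,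
solve the Schrödinger equation as soon as `ζ` solves the Riccati equation
`ζ' = i (α ζ² - 2 ω ζ + ᾱ)` (`IsNumberBasis.exists_isSolution`). The initial values of these
solutions are total. For a symmetric operator that is enough: classical solutions conserve the norm,
so they define isometries on a dense invariant subspace, these extend to a unitary group, pairing
with solutions identifies the derivative of the group on the whole domain, and every other evolution
has to follow the same solutions (`exists_isEvolution`). No self-adjointness theory is needed.

The Riccati equation is solved by an explicit Möbius flow `M(t)` of the disk, and `U(t)` maps the
line of `ψ(z)` to that of `ψ(M(t) z)`. At the fixed points `ξ₋` and `ξ₊` the flow satisfies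
`M(t) z - ξ = exp (∓ i λ t) (z - ξ) / (v̄ z + ū)` (`flowNum_sub`). In a suitable Möbius coordinate it
is therefore a rotation, a translation or a dilation, and the orbits are read off there.
-/

namespace Squeezed

/-! ### Graphs of products and sums of operators, and closed operators -/

section Graphs

variable {H : Type*} [NormedAddCommGroup H] [InnerProductSpace ℂ H]

theorem exists_apply_eq_of_mem_graph {T : H →ₗ.[ℂ] H} {x y : H} (h : (x, y) ∈ T.graph) :
    ∃ hx : x ∈ T.domain, T ⟨x, hx⟩ = y := by
  rw [LinearPMap.mem_graph_iff] at h
  obtain ⟨x', rfl, rfl⟩ := h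
  exact ⟨x'.2, rfl⟩

theorem mem_graph_opMul {S T : H →ₗ.[ℂ] H} {x z : H} :
    (x, z) ∈ (opMul S T).graph ↔ ∃ y, (x, y) ∈ T.graph ∧ (y, z) ∈ S.graph := by
  constructor
  · intro h
    rw [LinearPMap.mem_graph_iff] at h
    obtain ⟨⟨x', hx'⟩, rfl, rfl⟩ := h
    obtain ⟨y, hy, rfl⟩ := hx'
    exact ⟨T y, T.mem_graph y, S.mem_graph ⟨T y, hy⟩⟩
  · rintro ⟨y, hxy, hyz⟩
    obtain ⟨hx, rfl⟩ := exists_apply_eq_of_mem_graph hxy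
    obtain ⟨hy, rfl⟩ := exists_apply_eq_of_mem_graph hyz
    exact (opMul S T).mem_graph ⟨x, ⟨x, hx⟩, hy, rfl⟩

theorem mem_graph_add {S T : H →ₗ.[ℂ] H} {x w : H} :
    (x, w) ∈ (S + T).graph ↔
      ∃ y z, (x, y) ∈ S.graph ∧ (x, z) ∈ T.graph ∧ w = y + z := by
  constructor
  · intro h
    rw [LinearPMap.mem_graph_iff] at h
    obtain ⟨⟨x', hx'⟩, rfl, rfl⟩ := h
    exact ⟨S ⟨x', hx'.1⟩, T ⟨x', hx'.2⟩, S.mem_graph ⟨x', hx'.1⟩, T.mem_graph ⟨x', hx'.2⟩, rfl⟩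
  · rintro ⟨y, z, hy, hz, rfl⟩
    obtain ⟨hx, rfl⟩ := exists_apply_eq_of_mem_graph hy
    obtain ⟨hx', rfl⟩ := exists_apply_eq_of_mem_graph hz
    exact (S + T).mem_graph ⟨x, hx, hx'⟩

theorem mem_graph_smul {T : H →ₗ.[ℂ] H} {c : ℂ} {x w : H} :
    (x, w) ∈ (c • T).graph ↔ ∃ y, (x, y) ∈ T.graph ∧ w = c • y := by
  constructor
  · intro h
    rw [LinearPMap.mem_graph_iff] at h
    obtain ⟨x', rfl, rfl⟩ := h
    exact ⟨T x', T.mem_graph x', rfl⟩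
  · rintro ⟨y, hy, rfl⟩
    rw [LinearPMap.mem_graph_iff] at hy
    obtain ⟨x', rfl, rfl⟩ := hy
    exact (c • T).mem_graph x'

theorem mem_graph_opOne {x y : H} : (x, y) ∈ (opOne : H →ₗ.[ℂ] H).graph ↔ y = x := by
  constructor
  · intro h
    rw [LinearPMap.mem_graph_iff] at h
    obtain ⟨x', rfl, rfl⟩ := h
    rfl
  · rintro rfl
    exact (opOne : H →ₗ.[ℂ] H).mem_graph ⟨y, trivial⟩

theorem mem_graph_of_tendsto {T : H →ₗ.[ℂ] H} (hT : T.IsClosed) {f g : ℕ → H} {x y : H}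
    (hf : Tendsto f atTop (𝓝 x)) (hg : Tendsto g atTop (𝓝 y)) (h : ∀ N, (f N, g N) ∈ T.graph) :
    (x, y) ∈ T.graph :=
  hT.mem_of_tendsto (hf.prodMk_nhds hg) (Eventually.of_forall h)

/-- If `a` lowers the ladder `e` and the coefficients of `x` and `y` match accordingly, then `x` cut
off after the term `N` and `y` cut off after the term `N - 1` form a pair in the graph of `a`. -/
theorem sum_mem_graph {a : H →ₗ.[ℂ] H} {e : ℕ → H} (h0 : (e 0, 0) ∈ a.graph)
    (hs : ∀ n : ℕ, (e (n + 1), (√(n + 1) : ℂ) • e n) ∈ a.graph) {c d : ℕ → ℂ}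
    (hcd : ∀ n : ℕ, d n = √(n + 1) * c (n + 1)) (N : ℕ) :
    (∑ n ∈ Finset.range (N + 1), c n • e n, ∑ n ∈ Finset.range N, d n • e n) ∈ a.graph := by
  induction N with
  | zero => simpa using a.graph.smul_mem (c 0) h0
  | succ N ih =>
    rw [Finset.sum_range_succ _ (N + 1), Finset.sum_range_succ (fun n => d n • e n) N]
    have := a.graph.add_mem ih (a.graph.smul_mem (c (N + 1)) (hs N))
    rw [Prod.smul_mk, Prod.mk_add_mk, smul_smul, mul_comm, ← hcd] at this
    exact this

variable [CompleteSpace H]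

theorem mem_graph_adjoint {T : H →ₗ.[ℂ] H} (hT : Dense (T.domain : Set H)) {x y : H} :
    (x, y) ∈ T.adjoint.graph ↔ ∀ u v, (u, v) ∈ T.graph → ⟪u, y⟫_ℂ = ⟪v, x⟫_ℂ := by
  rw [LinearPMap.adjoint_graph_eq_graph_adjoint hT, Submodule.mem_adjoint_iff]
  simp only [sub_eq_zero]
  exact forall_congr' fun u => forall_congr' fun v => imp_congr_right fun _ => eq_comm

theorem mem_squeezedLine {a : H →ₗ.[ℂ] H} {z : ℂ} {x : H} :
    x ∈ squeezedLine a z ↔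
      ∃ y w, (x, y) ∈ a.graph ∧ (x, w) ∈ a.adjoint.graph ∧ y + z • w = 0 := by
  have h : x ∈ squeezedLine a z ↔ (x, (0 : H)) ∈ (a + z • a.adjoint).graph := by
    rw [LinearPMap.mem_graph_iff]
    constructor
    · rintro ⟨y, hy, rfl⟩
      exact ⟨y, rfl, hy⟩
    · rintro ⟨y, rfl, hy⟩
      exact ⟨y, hy, rfl⟩
  rw [h, mem_graph_add]
  constructor
  · rintro ⟨y, w, hy, hw, h0⟩
    obtain ⟨v, hv, rfl⟩ := mem_graph_smul.1 hw
    exact ⟨y, v, hy, hv, h0.symm⟩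
  · rintro ⟨y, w, hy, hw, h0⟩
    exact ⟨y, z • w, hy, mem_graph_smul.2 ⟨w, hw, rfl⟩, h0.symm⟩

theorem mem_graph_hamiltonian {a : H →ₗ.[ℂ] H} {ω : ℝ} {α : ℂ} {x w : H} :
    (x, w) ∈ (hamiltonian a ω α).graph ↔ ∃ y y' n q q',
      (x, y) ∈ a.graph ∧ (x, y') ∈ a.adjoint.graph ∧ (y, n) ∈ a.adjoint.graph ∧
      (y, q) ∈ a.graph ∧ (y', q') ∈ a.adjoint.graph ∧
      w = (ω : ℂ) • n + (α / 2) • q + (conj α / 2) • q' := by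
  simp only [hamiltonian, mem_graph_add, mem_graph_smul, mem_graph_opMul]
  constructor
  · rintro ⟨_, _, ⟨_, _, ⟨n, ⟨y, hy, hn⟩, rfl⟩, ⟨q, ⟨y₂, hy₂, hq⟩, rfl⟩, rfl⟩,
      ⟨q', ⟨y', hy', hq'⟩, rfl⟩, rfl⟩
    obtain rfl := a.mem_graph_snd_inj hy hy₂ rfl
    exact ⟨y, y', n, q, q', hy, hy', hn, hq, hq', rfl⟩
  · rintro ⟨y, y', n, q, q', hy, hy', hn, hq, hq', rfl⟩
    exact ⟨_, _, ⟨_, _, ⟨n, ⟨y, hy, hn⟩, rfl⟩, ⟨q, ⟨y, hy, hq⟩, rfl⟩, rfl⟩,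
      ⟨q', ⟨y', hy', hq'⟩, rfl⟩, rfl⟩

/-- For a closed operator `T`, the operator `1 + T†T` is surjective: the component of `(h, 0)`
orthogonal to the graph of `T` is `(T†T x, -T x)`, where `(x, T x)` is the component in the
graph. -/
theorem exists_add_adjoint_mul_self {T : H →ₗ.[ℂ] H} (hc : T.IsClosed)
    (hd : Dense (T.domain : Set H)) (h : H) :
    ∃ x y w, (x, y) ∈ T.graph ∧ (y, w) ∈ T.adjoint.graph ∧ x + w = h := by
  let e := (WithLp.linearEquiv 2 ℂ (H × H)).symm
  let G : Submodule ℂ (WithLp 2 (H × H)) := T.graph.map (e : (H × H) →ₗ[ℂ] WithLp 2 (H × H))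
  have hG : IsClosed (G : Set (WithLp 2 (H × H))) := by
    have : (G : Set (WithLp 2 (H × H))) = WithLp.ofLp ⁻¹' (T.graph : Set (H × H)) := by
      ext p
      constructor
      · rintro ⟨q, hq, rfl⟩
        exact hq
      · intro hp
        exact ⟨p.ofLp, hp, rfl⟩
    rw [this]
    exact hc.preimage (WithLp.prod_continuous_ofLp 2 H H)
  have : CompleteSpace G := hG.completeSpace_coe
  obtain ⟨p, hp, q, hq, hpq⟩ := G.exists_add_mem_mem_orthogonal (WithLp.toLp 2 (h, (0 : H)))
  obtain ⟨⟨x, y⟩, hxy, rfl⟩ := hp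
  have h1 : h = x + q.fst := congrArg WithLp.fst hpq
  have h2 : 0 = y + q.snd := congrArg WithLp.snd hpq
  refine ⟨x, y, q.fst, hxy, ?_, h1.symm⟩
  rw [mem_graph_adjoint hd]
  intro u v huv
  have h3 := (Submodule.mem_orthogonal _ _).1 hq (e (u, v)) ⟨(u, v), huv, rfl⟩
  rw [WithLp.prod_inner_apply] at h3
  have h4 : ⟪u, q.fst⟫_ℂ + ⟪v, q.snd⟫_ℂ = 0 := h3
  rw [eq_neg_of_add_eq_zero_left h2.symm, inner_neg_right]
  linear_combination h4

end Graphs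

/-! ### The number basis of an irreducible representation -/

section Ladder

variable {H : Type*} [NormedAddCommGroup H] [InnerProductSpace ℂ H] [CompleteSpace H]
  {a : H →ₗ.[ℂ] H}

/-- The canonical commutation relation, on the level of graphs. -/
theorem IsIrreducibleCCR.graph_iff (ha : IsIrreducibleCCR a) {x z : H} :
    (∃ y, (x, y) ∈ a.adjoint.graph ∧ (y, z + x) ∈ a.graph) ↔
      ∃ y, (x, y) ∈ a.graph ∧ (y, z) ∈ a.adjoint.graph := by
  rw [← mem_graph_opMul, ← mem_graph_opMul, ha.ccr, mem_graph_add]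
  simp only [mem_graph_opOne]
  constructor
  · rintro ⟨y, w, hy, rfl, hyw⟩
    rwa [add_right_cancel hyw]
  · intro h
    exact ⟨z, x, h, rfl, rfl⟩

theorem inner_of_mem_graph (hd : Dense (a.domain : Set H)) {u v x y : H}
    (huv : (u, v) ∈ a.graph) (hxy : (x, y) ∈ a.adjoint.graph) : ⟪u, y⟫_ℂ = ⟪v, x⟫_ℂ :=
  (mem_graph_adjoint hd).1 hxy u v huv

/-- If `a` were injective, `‖a x‖² ≥ n ‖x‖²` would hold on `D(a)` for every `n`. In the induction
step, `x = a† y` with `a a† y = a x`, so that `‖x‖² = ⟪a x, y⟫ ≤ ‖a x‖ ‖y‖`, while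
`‖x‖² = ‖a y‖² + ‖y‖² ≥ (n + 1) ‖y‖²` by the commutation relation. -/
theorem IsIrreducibleCCR.le_norm_sq_of_injective (ha : IsIrreducibleCCR a)
    (hker : ∀ x, (x, 0) ∈ a.graph → x = 0) (n : ℕ) :
    ∀ x y, (x, y) ∈ a.graph → n * ‖x‖ ^ 2 ≤ ‖y‖ ^ 2 := by
  induction n with
  | zero => intro x y _; simp
  | succ n ih =>
    intro x v hx
    obtain ⟨y, z, w, hyz, hzw, hv⟩ := exists_add_adjoint_mul_self ha.closed ha.dense v
    obtain ⟨x', hyx', hx'⟩ := ha.graph_iff.2 ⟨z, hyz, hzw⟩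
    rw [add_comm, hv] at hx'
    have h0 : x' - x = 0 := by
      apply hker
      have := a.graph.sub_mem hx' hx
      rwa [Prod.mk_sub_mk, sub_self] at this
    obtain rfl : x' = x := sub_eq_zero.1 h0
    have h1 : ⟪x', x'⟫_ℂ = ⟪v, y⟫_ℂ := inner_of_mem_graph ha.dense hx hyx'
    have h2 : ⟪y, w⟫_ℂ = ⟪z, z⟫_ℂ := inner_of_mem_graph ha.dense hyz hzw
    have h3 : ‖x'‖ ^ 2 ≤ ‖v‖ * ‖y‖ := by
      have := norm_inner_le_norm (𝕜 := ℂ) v y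
      rw [← h1, inner_self_eq_norm_sq_to_K] at this
      simpa using this
    have h4 : ‖x'‖ ^ 2 = ‖y‖ ^ 2 + ‖z‖ ^ 2 := by
      have h5 : ⟪v, y⟫_ℂ = ⟪y, y⟫_ℂ + ⟪w, y⟫_ℂ := by rw [← hv, inner_add_left]
      have h6 : ⟪w, y⟫_ℂ = ⟪z, z⟫_ℂ := by
        rw [← inner_conj_symm, h2, inner_conj_symm]
      rw [← h1, h6, inner_self_eq_norm_sq_to_K, inner_self_eq_norm_sq_to_K,
        inner_self_eq_norm_sq_to_K] at h5
      exact_mod_cast h5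
    have h5 := ih y z hyz
    push_cast
    have h6 : ((n : ℝ) + 1) * ‖y‖ ^ 2 ≤ ‖x'‖ ^ 2 := by rw [h4]; linarith
    rcases eq_or_ne y 0 with rfl | hy
    · simp only [norm_zero, mul_zero] at h3
      have : ‖x'‖ ^ 2 = 0 := le_antisymm h3 (sq_nonneg _)
      rw [this, mul_zero]
      positivity
    · have hy' : 0 < ‖y‖ ^ 2 := by positivity
      have h7 : (‖x'‖ ^ 2) ^ 2 ≤ ‖v‖ ^ 2 * ‖y‖ ^ 2 := by
        rw [← mul_pow]
        exact pow_le_pow_left₀ (by positivity) h3 2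
      have h8 : ((n + 1) * ‖x'‖ ^ 2) * ‖y‖ ^ 2 ≤ ‖v‖ ^ 2 * ‖y‖ ^ 2 := by
        nlinarith [sq_nonneg ‖x'‖]
      exact le_of_mul_le_mul_right h8 hy'

theorem IsIrreducibleCCR.exists_vacuum [Nontrivial H] (ha : IsIrreducibleCCR a) :
    ∃ x : H, ‖x‖ = 1 ∧ (x, 0) ∈ a.graph := by
  by_contra! hne
  have hker : ∀ x, (x, 0) ∈ a.graph → x = 0 := by
    intro x hx
    by_contra h0
    refine hne (((‖x‖⁻¹ : ℝ) : ℂ) • x) ?_ ?_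
    · rw [norm_smul, Complex.norm_real, norm_inv, norm_norm,
        inv_mul_cancel₀ (norm_ne_zero_iff.2 h0)]
    · have := a.graph.smul_mem ((‖x‖⁻¹ : ℝ) : ℂ) hx
      rwa [Prod.smul_mk, smul_zero] at this
  obtain ⟨x, hx, h0⟩ : ∃ x ∈ a.domain, x ≠ 0 := by
    by_contra! h
    obtain ⟨u, hu⟩ := exists_ne (0 : H)
    apply hu
    have h1 : (a.domain : Set H) ⊆ {0} := fun x hx => h x hx
    have h2 := closure_mono h1
    rw [ha.dense.closure_eq, closure_singleton] at h2
    exact h2 (Set.mem_univ u)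
  obtain ⟨n, hn⟩ := exists_nat_gt (‖a ⟨x, hx⟩‖ ^ 2 / ‖x‖ ^ 2)
  have h1 := ha.le_norm_sq_of_injective hker n x _ (a.mem_graph ⟨x, hx⟩)
  have h2 : 0 < ‖x‖ ^ 2 := by positivity
  rw [div_lt_iff₀ h2] at hn
  linarith

/-- From a unit eigenvector `x` of `a†a` with eigenvalue `n`, the vector `a† x / √(n + 1)` is one
with eigenvalue `n + 1`. -/
theorem IsIrreducibleCCR.exists_raise (ha : IsIrreducibleCCR a) (n : ℕ) {x : H}
    (hx : ‖x‖ = 1 ∧ ∃ y, (x, y) ∈ a.graph ∧ (y, (n : ℂ) • x) ∈ a.adjoint.graph) :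
    ∃ x', (‖x'‖ = 1 ∧
        ∃ y, (x', y) ∈ a.graph ∧ (y, ((n + 1 : ℕ) : ℂ) • x') ∈ a.adjoint.graph) ∧
      (x, (√(n + 1) : ℂ) • x') ∈ a.adjoint.graph ∧ (x', (√(n + 1) : ℂ) • x) ∈ a.graph := by
  obtain ⟨h1, y, hxy, hy⟩ := hx
  obtain ⟨w, hxw, hw⟩ := ha.graph_iff.2 ⟨y, hxy, hy⟩
  have hpos : (0 : ℝ) < n + 1 := by positivity
  have hs : (√(n + 1) : ℂ) ≠ 0 := by
    simpa using (Real.sqrt_pos.2 hpos).ne'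
  have hs2 : (√(n + 1) : ℂ) * (√(n + 1) : ℂ) = n + 1 := by
    rw [← Complex.ofReal_mul, Real.mul_self_sqrt hpos.le]
    push_cast
    rfl
  have hw' : (w, ((n : ℂ) + 1) • x) ∈ a.graph := by rwa [add_smul, one_smul]
  have hnorm : ‖w‖ ^ 2 = n + 1 := by
    have h2 := inner_of_mem_graph ha.dense hw' hxw
    rw [inner_self_eq_norm_sq_to_K, inner_smul_left, inner_self_eq_norm_sq_to_K, h1] at h2
    simp only [map_add, Complex.conj_natCast, map_one] at h2
    have h3 : ((‖w‖ ^ 2 : ℝ) : ℂ) = ((n + 1 : ℝ) : ℂ) := by push_cast; simpa using h2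
    exact_mod_cast h3
  have hx1 : ((√(n + 1) : ℂ)⁻¹ • w, (√(n + 1) : ℂ) • x) ∈ a.graph := by
    have := a.graph.smul_mem (√(n + 1) : ℂ)⁻¹ hw'
    rwa [Prod.smul_mk, smul_smul, ← hs2, inv_mul_cancel_left₀ hs] at this
  refine ⟨(√(n + 1) : ℂ)⁻¹ • w, ⟨?_, (√(n + 1) : ℂ) • x, hx1, ?_⟩, ?_, hx1⟩
  · rw [norm_smul, norm_inv, Complex.norm_real, Real.norm_of_nonneg (Real.sqrt_nonneg _),
      ← hnorm, Real.sqrt_sq (norm_nonneg _), inv_mul_cancel₀]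
    intro h
    rw [h] at hnorm
    norm_num at hnorm
    linarith
  · have := a.adjoint.graph.smul_mem (√(n + 1) : ℂ) hxw
    rw [Prod.smul_mk] at this
    convert this using 2
    rw [smul_smul]
    push_cast
    rw [← hs2, mul_assoc, mul_inv_cancel₀ hs, mul_one]
  · rwa [smul_inv_smul₀ hs]

/-- A number basis for `a`: an orthonormal basis `b 0, b 1, …` in which `a` is the maximal weighted
shift `b (n + 1) ↦ √(n + 1) b n` and `a†` the maximal weighted shift `b n ↦ √(n + 1) b (n + 1)`. -/
structure IsNumberBasis (a : H →ₗ.[ℂ] H) (b : HilbertBasis ℕ ℂ H) : Prop where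
  graph_iff : ∀ x y, (x, y) ∈ a.graph ↔ ∀ n : ℕ, ⟪b n, y⟫_ℂ = √(n + 1) * ⟪b (n + 1), x⟫_ℂ
  adjoint_graph_iff : ∀ x y, (x, y) ∈ a.adjoint.graph ↔
    ⟪b 0, y⟫_ℂ = 0 ∧ ∀ n : ℕ, ⟪b (n + 1), y⟫_ℂ = √(n + 1) * ⟪b n, x⟫_ℂ

/-- The counterpart of `sum_mem_graph` for the raising operator `a†`. -/
theorem sum_mem_graph_adjoint {e : ℕ → H}
    (hs : ∀ n : ℕ, (e n, (√(n + 1) : ℂ) • e (n + 1)) ∈ a.adjoint.graph) {c d : ℕ → ℂ}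
    (h0 : d 0 = 0) (hcd : ∀ n : ℕ, d (n + 1) = √(n + 1) * c n) (N : ℕ) :
    (∑ n ∈ Finset.range N, c n • e n, ∑ n ∈ Finset.range (N + 1), d n • e n) ∈
      a.adjoint.graph := by
  induction N with
  | zero => simp [h0]
  | succ N ih =>
    rw [Finset.sum_range_succ _ (N + 1), Finset.sum_range_succ _ N]
    have := a.adjoint.graph.add_mem ih (a.adjoint.graph.smul_mem (c N) (hs N))
    rw [Prod.smul_mk, Prod.mk_add_mk, smul_smul, mul_comm, ← hcd] at this
    exact this

/-- The closed span of a ladder reduces `a`, hence is everything. The projection of `x ∈ D(a)` is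
the sum of its Fourier series, and `a` may be applied termwise because it is closed. -/
theorem IsIrreducibleCCR.span_eq_top (ha : IsIrreducibleCCR a) {e : ℕ → H} (he : Orthonormal ℂ e)
    (h0 : (e 0, 0) ∈ a.graph)
    (hs : ∀ n : ℕ, (e (n + 1), (√(n + 1) : ℂ) • e n) ∈ a.graph)
    (hr : ∀ n : ℕ, (e n, (√(n + 1) : ℂ) • e (n + 1)) ∈ a.adjoint.graph) :
    (Submodule.span ℂ (Set.range e)).topologicalClosure = ⊤ := by
  set K := (Submodule.span ℂ (Set.range e)).topologicalClosure with hK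
  have : CompleteSpace K := (Submodule.isClosed_topologicalClosure _).completeSpace_coe
  have hmem : ∀ n, e n ∈ K := fun n =>
    Submodule.le_topologicalClosure _ (Submodule.subset_span ⟨n, rfl⟩)
  have hsum : ∀ x : H, HasSum (fun n => ⟪e n, x⟫_ℂ • e n) (K.starProjection x) := by
    intro x
    have h1 : Summable fun n => ⟪e n, x⟫_ℂ • e n := by
      have := (he.orthogonalFamily.summable_iff_norm_sq_summable fun n => ⟪e n, x⟫_ℂ).2
        (he.inner_products_summable x)
      exact this
    have h2 : ∑' n, ⟪e n, x⟫_ℂ • e n ∈ K :=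
      (Submodule.isClosed_topologicalClosure _).mem_of_tendsto h1.hasSum
        (Eventually.of_forall fun s => Submodule.sum_mem _ fun n _ => K.smul_mem _ (hmem n))
    have h3 : x - ∑' n, ⟪e n, x⟫_ℂ • e n ∈ Kᗮ := by
      rw [hK, Submodule.orthogonal_closure, Submodule.mem_orthogonal]
      intro u hu
      induction hu using Submodule.span_induction with
      | mem u hu =>
        obtain ⟨m, rfl⟩ := hu
        have h4 := h1.hasSum.mapL (innerSL ℂ (e m))
        have h5 : HasSum (fun n => innerSL ℂ (e m) (⟪e n, x⟫_ℂ • e n)) ⟪e m, x⟫_ℂ := by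
          convert hasSum_ite_eq m ⟪e m, x⟫_ℂ using 2 with n
          rw [innerSL_apply_apply, inner_smul_right, orthonormal_iff_ite.1 he]
          rcases eq_or_ne n m with rfl | h
          · simp
          · simp [h, h.symm]
        rw [inner_sub_right, sub_eq_zero]
        exact h5.unique h4
      | zero => simp
      | add u v _ _ hu hv => rw [inner_add_left, hu, hv, add_zero]
      | smul c u _ hu => rw [inner_smul_left, hu, mul_zero]
    rw [Submodule.eq_starProjection_of_mem_orthogonal h2 h3]
    exact h1.hasSum
  have hred : ∀ x : a.domain, ∃ h : K.starProjection (x : H) ∈ a.domain,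
      a ⟨K.starProjection (x : H), h⟩ = K.starProjection (a x) := by
    intro x
    have h1 : (K.starProjection (x : H), K.starProjection (a x)) ∈ a.graph := by
      refine mem_graph_of_tendsto ha.closed
        ((tendsto_add_atTop_iff_nat 1).2 (hsum x).tendsto_sum_nat)
        (hsum (a x)).tendsto_sum_nat fun N => sum_mem_graph h0 hs (fun n => ?_) N
      have := inner_of_mem_graph ha.dense (a.mem_graph x) (hr n)
      rw [inner_smul_right] at this
      rw [← inner_conj_symm (e n), ← this, map_mul, inner_conj_symm, Complex.conj_ofReal]
    exact exists_apply_eq_of_mem_graph h1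
  rcases ha.irreducible K hred with h | h
  · have h1 := hmem 0
    rw [h, Submodule.mem_bot] at h1
    exact absurd h1 (he.ne_zero 0)
  · exact h

theorem IsIrreducibleCCR.exists_numberBasis [Nontrivial H] (ha : IsIrreducibleCCR a) :
    ∃ b : HilbertBasis ℕ ℂ H, IsNumberBasis a b := by
  obtain ⟨Ω, hΩ, hΩa⟩ := ha.exists_vacuum
  let Q : ℕ → H → Prop := fun n x =>
    ‖x‖ = 1 ∧ ∃ y, (x, y) ∈ a.graph ∧ (y, (n : ℂ) • x) ∈ a.adjoint.graph
  choose f hf using fun (n : ℕ) (x : H) (hx : Q n x) => ha.exists_raise n hx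
  have hQ0 : Q 0 Ω := ⟨hΩ, 0, hΩa, by simp⟩
  let E : ∀ n : ℕ, {x : H // Q n x} := fun n =>
    Nat.rec ⟨Ω, hQ0⟩ (fun n x => ⟨f n x.1 x.2, (hf n x.1 x.2).1⟩) n
  let e : ℕ → H := fun n => (E n).1
  have hQ : ∀ n, Q n (e n) := fun n => (E n).2
  have hr : ∀ n : ℕ, (e n, (√(n + 1) : ℂ) • e (n + 1)) ∈ a.adjoint.graph :=
    fun n => (hf n (E n).1 (E n).2).2.1
  have hs : ∀ n : ℕ, (e (n + 1), (√(n + 1) : ℂ) • e n) ∈ a.graph :=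
    fun n => (hf n (E n).1 (E n).2).2.2
  have h0 : (e 0, 0) ∈ a.graph := hΩa
  have he : Orthonormal ℂ e := by
    refine ⟨fun n => (hQ n).1, fun m n hmn => ?_⟩
    obtain ⟨-, y, hy, hy'⟩ := hQ m
    obtain ⟨-, w, hw, hw'⟩ := hQ n
    -- eigenvectors of `a†a` for the distinct eigenvalues `m` and `n`
    have h1 := inner_of_mem_graph ha.dense hy hw'
    have h2 := inner_of_mem_graph ha.dense hw hy'
    rw [inner_smul_right] at h1 h2
    have h3 := congrArg conj h2
    rw [map_mul, inner_conj_symm, inner_conj_symm, Complex.conj_natCast, ← h1] at h3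
    have h4 : ((m : ℂ) - n) * ⟪e m, e n⟫_ℂ = 0 := by linear_combination h3
    refine (mul_eq_zero.1 h4).resolve_left ?_
    exact sub_ne_zero.2 (Nat.cast_injective.ne hmn)
  have hsp := ha.span_eq_top he h0 hs hr
  let b := HilbertBasis.mk he hsp.ge
  have hb : ∀ n, b n = e n := fun n => by simp [b]
  have hsum : ∀ x, HasSum (fun n => ⟪e n, x⟫_ℂ • e n) x := by
    intro x
    have := b.hasSum_repr x
    simpa only [b.repr_apply_apply, hb] using this
  refine ⟨b, fun x y => ?_, fun x y => ?_⟩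
  · simp only [hb]
    constructor
    · intro hxy n
      have := inner_of_mem_graph ha.dense hxy (hr n)
      rw [inner_smul_right] at this
      rw [← inner_conj_symm (e n), ← this, map_mul, inner_conj_symm, Complex.conj_ofReal]
    · intro h
      exact mem_graph_of_tendsto ha.closed
        ((tendsto_add_atTop_iff_nat 1).2 (hsum x).tendsto_sum_nat) (hsum y).tendsto_sum_nat
        (sum_mem_graph h0 hs h)
  · simp only [hb]
    constructor
    · intro hxy
      refine ⟨?_, fun n => ?_⟩
      · rw [inner_of_mem_graph ha.dense h0 hxy, inner_zero_left]
      · rw [inner_of_mem_graph ha.dense (hs n) hxy, inner_smul_left, Complex.conj_ofReal]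
    · rintro ⟨h1, h2⟩
      exact mem_graph_of_tendsto (LinearPMap.adjoint_isClosed ha.dense)
        (hsum x).tendsto_sum_nat ((tendsto_add_atTop_iff_nat 1).2 (hsum y).tendsto_sum_nat)
        (sum_mem_graph_adjoint hr h1 h2)

end Ladder

/-! ### Unitary evolutions from classical solutions -/

section Evolution

variable {H : Type*} [NormedAddCommGroup H] [InnerProductSpace ℂ H] {A : H →ₗ.[ℂ] H}

/-- `u` is a global classical solution of the Schrödinger equation `u' = -i A u`: it stays in the
domain of `A` and is differentiable at all times. -/
def IsSolution (A : H →ₗ.[ℂ] H) (u : ℝ → H) : Prop :=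
  ∀ t, ∃ w, (u t, w) ∈ A.graph ∧ HasDerivAt u (-Complex.I • w) t

theorem IsSolution.add {u v : ℝ → H} (hu : IsSolution A u) (hv : IsSolution A v) :
    IsSolution A (fun t => u t + v t) := by
  intro t
  obtain ⟨w, hw, hw'⟩ := hu t
  obtain ⟨w₂, hw₂, hw₂'⟩ := hv t
  refine ⟨w + w₂, A.graph.add_mem hw hw₂, ?_⟩
  rw [smul_add]
  exact hw'.add hw₂'

theorem IsSolution.smul {u : ℝ → H} (c : ℂ) (hu : IsSolution A u) :
    IsSolution A (fun t => c • u t) := by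
  intro t
  obtain ⟨w, hw, hw'⟩ := hu t
  refine ⟨c • w, A.graph.smul_mem c hw, ?_⟩
  rw [smul_comm]
  exact hw'.const_smul c

theorem isSolution_zero : IsSolution A (fun _ => 0) :=
  fun t => ⟨0, A.graph.zero_mem, by simpa using hasDerivAt_const t (0 : H)⟩

theorem IsSolution.comp_add {u : ℝ → H} (hu : IsSolution A u) (s : ℝ) :
    IsSolution A (fun t => u (t + s)) := by
  intro t
  obtain ⟨w, hw, hw'⟩ := hu (t + s)
  exact ⟨w, hw, hw'.comp_add_const t s⟩

theorem IsSolution.continuous {u : ℝ → H} (hu : IsSolution A u) : Continuous u :=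
  continuous_iff_continuousAt.2 fun t => (hu t).choose_spec.2.continuousAt

/-- Symmetry of an operator, in terms of its graph. -/
def IsSymm (A : H →ₗ.[ℂ] H) : Prop :=
  ∀ x v y w, (x, v) ∈ A.graph → (y, w) ∈ A.graph → ⟪v, y⟫_ℂ = ⟪x, w⟫_ℂ

/-- Conservation of the norm, which implies uniqueness of classical solutions. -/
theorem IsSolution.norm_eq (hA : IsSymm A) {u : ℝ → H} (hu : IsSolution A u) (t : ℝ) :
    ‖u t‖ = ‖u 0‖ := by
  have h1 : ∀ t, HasDerivAt (fun t => ⟪u t, u t⟫_ℂ) 0 t := by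
    intro t
    obtain ⟨w, hw, hw'⟩ := hu t
    have h2 : HasDerivAt (fun t => ⟪u t, u t⟫_ℂ)
        (⟪u t, -Complex.I • w⟫_ℂ + ⟪-Complex.I • w, u t⟫_ℂ) t := hw'.inner ℂ hw'
    rw [inner_smul_right, inner_smul_left, hA _ _ _ _ hw hw] at h2
    simpa using h2
  have h2 := is_const_of_deriv_eq_zero (fun t => (h1 t).differentiableAt) (fun t => (h1 t).deriv)
    t 0
  simp only [inner_self_eq_norm_sq_to_K] at h2
  have h3 : ‖u t‖ ^ 2 = ‖u 0‖ ^ 2 := by exact_mod_cast h2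
  exact (sq_eq_sq₀ (norm_nonneg _) (norm_nonneg _)).1 h3

theorem IsSolution.eq (hA : IsSymm A) {u v : ℝ → H} (hu : IsSolution A u) (hv : IsSolution A v)
    (h : u 0 = v 0) : u = v := by
  have h1 := hu.add (hv.smul (-1))
  ext t
  have h2 := h1.norm_eq hA t
  simp only [h, neg_smul, one_smul, add_neg_cancel, norm_zero, norm_eq_zero] at h2
  exact add_neg_eq_zero.1 h2

/-- The initial values of the global classical solutions of `u' = -i A u`. -/
def solutionSpace (A : H →ₗ.[ℂ] H) : Submodule ℂ H where
  carrier := {x | ∃ u, IsSolution A u ∧ u 0 = x}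
  zero_mem' := ⟨_, isSolution_zero, rfl⟩
  add_mem' := by
    rintro _ _ ⟨u, hu, rfl⟩ ⟨v, hv, rfl⟩
    exact ⟨_, hu.add hv, rfl⟩
  smul_mem' := by
    rintro c _ ⟨u, hu, rfl⟩
    exact ⟨_, hu.smul c, rfl⟩

theorem IsSolution.mem_solutionSpace {u : ℝ → H} (hu : IsSolution A u) (t : ℝ) :
    u t ∈ solutionSpace A :=
  ⟨_, hu.comp_add t, by rw [zero_add]⟩

variable [CompleteSpace H]

/-- By uniqueness and conservation of the norm, `u 0 ↦ u t` is a linear isometry on the space of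
initial values, and extends to the whole space if that space is dense. -/
theorem exists_propagator (hA : IsSymm A) (hd : Dense (solutionSpace A : Set H)) (t : ℝ) :
    ∃ U : H →L[ℂ] H, (∀ u, IsSolution A u → U (u 0) = u t) ∧ ∀ x, ‖U x‖ = ‖x‖ := by
  choose S hS hS0 using fun x : solutionSpace A => x.2
  have hS' : ∀ (x : solutionSpace A) u, IsSolution A u → u 0 = x → S x = u :=
    fun x u hu h => (hS x).eq hA hu ((hS0 x).trans h.symm)
  let L : solutionSpace A →ₗ[ℂ] H :=
    { toFun := fun x => S x t
      map_add' := fun x y => by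
        rw [hS' (x + y) _ ((hS x).add (hS y)) (by simp [hS0])]
      map_smul' := fun c x => by
        rw [hS' (c • x) _ ((hS x).smul c) (by simp [hS0])]
        rfl }
  have hL : ∀ x, ‖L x‖ = ‖x‖ := fun x => by
    have := (hS x).norm_eq hA t
    rw [hS0] at this
    exact this
  have hdr : DenseRange (solutionSpace A).subtype := by
    rw [DenseRange, Submodule.coe_subtype, Subtype.range_coe_subtype]
    exact hd
  have hext : ∀ x : solutionSpace A, L.extendOfNorm (solutionSpace A).subtype x = L x :=
    fun x => LinearMap.extendOfNorm_eq hdr ⟨1, fun y => by rw [hL, one_mul]; rfl⟩ x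
  refine ⟨L.extendOfNorm (solutionSpace A).subtype, fun u hu => ?_, fun x => ?_⟩
  · have := hext ⟨u 0, u, hu, rfl⟩
    rw [show ((⟨u 0, u, hu, rfl⟩ : solutionSpace A) : H) = u 0 from rfl] at this
    rw [this]
    exact congrFun (hS' ⟨u 0, u, hu, rfl⟩ u hu rfl) t
  · refine hd.induction (P := fun x => ‖L.extendOfNorm (solutionSpace A).subtype x‖ = ‖x‖)
      (fun x hx => ?_) (isClosed_eq (by fun_prop) (by fun_prop)) x
    rw [hext ⟨x, hx⟩, hL]
    rfl

theorem IsEvolution.hasDerivAt {V : ℝ → H →L[ℂ] H} (hV : IsEvolution A V) {x w : H}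
    (hx : (x, w) ∈ A.graph) (t : ℝ) : HasDerivAt (fun t => V t x) (V t (-Complex.I • w)) t := by
  obtain ⟨h1, rfl⟩ := exists_apply_eq_of_mem_graph hx
  have h2 := hV.generator ⟨x, h1⟩
  have h3 : HasDerivAt (fun s => V (s - t) x) (-Complex.I • A ⟨x, h1⟩) t := by
    rw [← sub_self t] at h2
    exact h2.comp_sub_const t t
  have h4 := (V t).hasFDerivAt.restrictScalars ℝ |>.comp_hasDerivAt t h3
  refine h4.congr_of_eventuallyEq (Eventually.of_forall fun s => ?_)
  have := hV.add t (s - t)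
  rw [add_sub_cancel] at this
  simp [this]

/-- Any evolution generated by `A` follows the classical solutions: if `u` is one, then
`t ↦ V (-t) (u t)` has derivative zero. -/
theorem IsEvolution.apply_eq {V : ℝ → H →L[ℂ] H} (hV : IsEvolution A V) {u : ℝ → H}
    (hu : IsSolution A u) (t : ℝ) : V t (u 0) = u t := by
  have h1 : ∀ t, HasDerivAt (fun t => V (-t) (u t)) 0 t := by
    intro t
    obtain ⟨w, hw, hw'⟩ := hu t
    have h2 : HasDerivAt (fun s => V (-s) (u t)) (-V (-t) (-Complex.I • w)) t := by
      have := (hV.hasDerivAt hw (-t)).scomp t (hasDerivAt_neg t)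
      simpa [Function.comp_def] using this
    have h3 : Tendsto (fun s => V (-s) (slope u t s)) (𝓝[≠] t) (𝓝 (V (-t) (-Complex.I • w))) := by
      have h4 : Tendsto (fun s => V (-s) (-Complex.I • w)) (𝓝[≠] t) (𝓝 (V (-t) (-Complex.I • w))) :=
        (((hV.continuous (-Complex.I • w)).comp continuous_neg).tendsto t).mono_left
          nhdsWithin_le_nhds
      have h5 : Tendsto (fun s => V (-s) (slope u t s - -Complex.I • w)) (𝓝[≠] t) (𝓝 0) := by
        rw [tendsto_zero_iff_norm_tendsto_zero]
        simp only [ContinuousLinearMap.norm_map_of_mem_unitary (hV.unitary _)]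
        rw [← tendsto_zero_iff_norm_tendsto_zero, ← sub_self (-Complex.I • w)]
        exact (hasDerivAt_iff_tendsto_slope.1 hw').sub_const _
      have h6 := h5.add h4
      rw [zero_add] at h6
      refine h6.congr fun s => ?_
      rw [← map_add, sub_add_cancel]
    rw [hasDerivAt_iff_tendsto_slope] at h2 ⊢
    have h7 := h2.add h3
    rw [neg_add_cancel] at h7
    refine h7.congr fun s => ?_
    simp only [slope_def_module, (V (-s)).map_smul_of_tower, map_sub]
    module
  have h2 := is_const_of_deriv_eq_zero (fun t => (h1 t).differentiableAt) (fun t => (h1 t).deriv)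
    t 0
  rw [neg_zero, hV.zero, one_apply_eq_self] at h2
  rw [← h2, ← mul_apply_eq_comp, ← hV.add, add_neg_cancel, hV.zero]
  rfl

/-- A symmetric operator with a dense set of initial values of global classical solutions of the
Schrödinger equation (in particular, an essentially self-adjoint one) generates one and only one
unitary evolution. -/
theorem exists_isEvolution (hA : IsSymm A) (hd : Dense (solutionSpace A : Set H)) :
    ∃ U : ℝ → H →L[ℂ] H, IsEvolution A U ∧ ∀ V, IsEvolution A V → V = U := by
  choose U hU hUn using exists_propagator hA hd
  have hext : ∀ S T : H →L[ℂ] H, (∀ u, IsSolution A u → S (u 0) = T (u 0)) → S = T := by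
    intro S T h
    refine ContinuousLinearMap.coeFn_injective (Continuous.ext_on hd S.continuous T.continuous ?_)
    rintro _ ⟨u, hu, rfl⟩
    exact h u hu
  have hzero : U 0 = 1 := hext _ _ fun u hu => hU 0 u hu
  have hadd : ∀ s t, U (s + t) = U s * U t := by
    intro s t
    refine hext _ _ fun u hu => ?_
    rw [hU _ u hu, mul_apply_eq_comp, hU t u hu]
    have := hU s _ (hu.comp_add t)
    rw [zero_add] at this
    exact this.symm
  have hadj : ∀ t x y, ⟪U t x, y⟫_ℂ = ⟪x, U (-t) y⟫_ℂ := by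
    intro t x y
    have h1 : ∀ x y, ⟪U t x, U t y⟫_ℂ = ⟪x, y⟫_ℂ :=
      (LinearMap.norm_map_iff_inner_map_map (U t)).1 (hUn t)
    have h2 : U t (U (-t) y) = y := by
      rw [← mul_apply_eq_comp, ← hadd, add_neg_cancel, hzero]
      rfl
    rw [← h1 x, h2]
  have hunit : ∀ t, U t ∈ unitary (H →L[ℂ] H) := by
    intro t
    have h1 : star (U t) = U (-t) := by
      rw [ContinuousLinearMap.star_eq_adjoint]
      symm
      rw [ContinuousLinearMap.eq_adjoint_iff]
      intro x y
      rw [hadj, neg_neg]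
    rw [Unitary.mem_iff, h1, ← hadd, ← hadd, neg_add_cancel, add_neg_cancel, hzero]
    exact ⟨rfl, rfl⟩
  have hcont : ∀ x, Continuous fun t => U t x := by
    intro x
    refine continuous_of_uniform_approx_of_continuous fun W hW => ?_
    obtain ⟨ε, hε, hεW⟩ := Metric.mem_uniformity_dist.1 hW
    obtain ⟨_, hy, u, hu, rfl⟩ := Metric.dense_iff.1 hd x ε hε
    refine ⟨u, hu.continuous, fun t => hεW ?_⟩
    rw [← hU t u hu, dist_eq_norm, ← map_sub, hUn, ← dist_eq_norm, dist_comm]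
    exact hy
  refine ⟨U, ⟨hunit, hzero, hadd, hcont, fun x => ?_⟩, fun V hV => ?_⟩
  · -- pairing with a classical solution shows that `U t x - x` is the integral of
    -- `U s (-i A x)` over `[0, t]`
    set w := -Complex.I • A x with hw
    have hint : ∀ t, U t x = x + ∫ s in (0 : ℝ)..t, U s w := by
      intro t
      refine hd.eq_of_inner_right ℂ fun y hy => ?_
      obtain ⟨u, hu, rfl⟩ := hy
      have h1 : ∀ t, HasDerivAt (fun t => ⟪u 0, U t x⟫_ℂ) ⟪u 0, U t w⟫_ℂ t := by
        intro t
        obtain ⟨v, hv, hv'⟩ := hu (-t)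
        have h2 : HasDerivAt (fun t => u (-t)) (-(-Complex.I • v)) t := by
          simpa [Function.comp_def] using hv'.scomp t (hasDerivAt_neg t)
        have h3 : HasDerivAt (fun t => ⟪u (-t), (x : H)⟫_ℂ)
            (⟪u (-t), (0 : H)⟫_ℂ + ⟪-(-Complex.I • v), (x : H)⟫_ℂ) t :=
          h2.inner ℂ (hasDerivAt_const t (x : H))
        have h4 : ∀ s y, ⟪u 0, U s y⟫_ℂ = ⟪u (-s), y⟫_ℂ := by
          intro s y
          rw [← hU (-s) u hu, hadj, neg_neg]
        simp only [h4]
        rw [inner_zero_right, zero_add, neg_smul, neg_neg, inner_smul_left,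
          hA _ _ _ _ hv (A.mem_graph x), Complex.conj_I, ← inner_smul_right] at h3
        exact h3
      have h2 : ∀ t, HasDerivAt (fun t => ⟪u 0, x + ∫ s in (0 : ℝ)..t, U s w⟫_ℂ)
          ⟪u 0, U t w⟫_ℂ t := by
        intro t
        have h3 := ((hcont w).integral_hasStrictDerivAt 0 t).hasDerivAt.const_add (x : H)
        have h4 : HasDerivAt (fun t => ⟪u 0, x + ∫ s in (0 : ℝ)..t, U s w⟫_ℂ)
            (⟪u 0, U t w⟫_ℂ + ⟪(0 : H), x + ∫ s in (0 : ℝ)..t, U s w⟫_ℂ) t :=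
          (hasDerivAt_const t (u 0)).inner ℂ h3
        rwa [inner_zero_left, add_zero] at h4
      have h3 : ∀ t, HasDerivAt (fun t => ⟪u 0, U t x⟫_ℂ -
          ⟪u 0, x + ∫ s in (0 : ℝ)..t, U s w⟫_ℂ) 0 t := by
        intro t
        have := (h1 t).sub (h2 t)
        rwa [sub_self] at this
      have h4 := is_const_of_deriv_eq_zero (fun t => (h3 t).differentiableAt)
        (fun t => (h3 t).deriv) t 0
      simp only [hzero, intervalIntegral.integral_same, add_zero,
        one_apply_eq_self, sub_self] at h4
      exact sub_eq_zero.1 h4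
    have h5 := ((hcont w).integral_hasStrictDerivAt 0 0).hasDerivAt.const_add (x : H)
    rw [hzero] at h5
    exact h5.congr_of_eventuallyEq (Eventually.of_forall hint)
  · ext1 t
    refine hext _ _ fun u hu => ?_
    rw [hU t u hu, hV.apply_eq hu]

end Evolution

/-! ### Squeezed vectors as power series in the squeezing parameter -/

section GaussianVectors

variable {H : Type*} [NormedAddCommGroup H] [InnerProductSpace ℂ H]

/-- The unnormalized number state `a†ⁿ Ω = √n! b n`. -/
noncomputable def powVec (b : HilbertBasis ℕ ℂ H) (n : ℕ) : H := (√(n.factorial) : ℂ) • b n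

/-- The Taylor coefficients of `exp (-z / 2)` at the origin. -/
noncomputable def gaussCoeff (k : ℕ) : ℂ := (-1 / 2) ^ k / k.factorial

theorem succ_mul_gaussCoeff_succ (k : ℕ) :
    (k + 1) * gaussCoeff (k + 1) = -1 / 2 * gaussCoeff k := by
  have h1 : (k.factorial : ℂ) ≠ 0 := by exact_mod_cast k.factorial_ne_zero
  have h2 : (k + 1 : ℂ) ≠ 0 := by exact_mod_cast k.succ_ne_zero
  rw [gaussCoeff, gaussCoeff, Nat.factorial_succ]
  push_cast
  field_simp
  ring

/-- The vector `a†ᵐ exp (-z a†² / 2) Ω`, as a power series in `z`. -/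
noncomputable def gaussVec (b : HilbertBasis ℕ ℂ H) (m : ℕ) (z : ℂ) : H :=
  ∑' k : ℕ, z ^ k • gaussCoeff k • powVec b (2 * k + m)

theorem norm_powVec (b : HilbertBasis ℕ ℂ H) (n : ℕ) : ‖powVec b n‖ = √(n.factorial) := by
  rw [powVec, norm_smul, Complex.norm_real, Real.norm_of_nonneg (Real.sqrt_nonneg _),
    b.orthonormal.1, mul_one]

theorem factorial_two_mul_add_le (k m : ℕ) :
    (2 * k + m).factorial ≤ 4 ^ k * k.factorial ^ 2 * ((m + 2) * (k + 1)) ^ m := by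
  rw [← Nat.factorial_mul_ascFactorial]
  refine Nat.mul_le_mul ?_ ?_
  · have h1 := Nat.choose_mul_factorial_mul_factorial (show k ≤ 2 * k by omega)
    rw [← Nat.centralBinom_eq_two_mul_choose, show 2 * k - k = k by omega] at h1
    rw [← h1, mul_assoc, sq]
    exact Nat.mul_le_mul_right _ k.centralBinom_le_four_pow
  · refine (Nat.ascFactorial_le_pow_add _ _).trans (Nat.pow_le_pow_left ?_ _)
    nlinarith [Nat.zero_le (m * k)]

theorem norm_gauss_term_le (b : HilbertBasis ℕ ℂ H) (m k : ℕ) :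
    ‖gaussCoeff k • powVec b (2 * k + m)‖ ≤ ((m + 2 : ℝ) * (k + 1)) ^ m := by
  have h1 : (1 : ℝ) ≤ ((m + 2 : ℝ) * (k + 1)) ^ m :=
    one_le_pow₀ (by nlinarith [m.cast_nonneg (α := ℝ), k.cast_nonneg (α := ℝ)])
  have h2 : ((2 * k + m).factorial : ℝ) ≤
      (2 ^ k * k.factorial) ^ 2 * ((m + 2 : ℝ) * (k + 1)) ^ m := by
    have := factorial_two_mul_add_le k m
    have h3 : ((2 : ℝ) ^ k * k.factorial) ^ 2 = 4 ^ k * k.factorial ^ 2 := by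
      rw [mul_pow, ← pow_mul, mul_comm k 2, pow_mul]
      norm_num
    rw [h3]
    exact_mod_cast this
  have h4 : ‖gaussCoeff k‖ = ((2 : ℝ) ^ k * k.factorial)⁻¹ := by
    rw [gaussCoeff, norm_div, norm_pow]
    norm_num
    rw [one_div, inv_pow]
    field_simp
  have h5 : (0 : ℝ) < 2 ^ k * k.factorial := by positivity
  rw [norm_smul, norm_powVec, h4, inv_mul_le_iff₀ h5]
  refine Real.sqrt_le_iff.2 ⟨by positivity, h2.trans ?_⟩
  have h6 := mul_le_mul_of_nonneg_left (le_self_pow₀ h1 two_ne_zero)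
    (sq_nonneg (2 ^ k * k.factorial : ℝ))
  rwa [← mul_pow] at h6

theorem summable_gauss_norm (b : HilbertBasis ℕ ℂ H) (m : ℕ) {r : ℝ} (h0 : 0 < r) (h1 : r < 1) :
    Summable fun k : ℕ => r ^ k * ‖gaussCoeff k • powVec b (2 * k + m)‖ := by
  have h2 := summable_pow_mul_geometric_of_norm_lt_one m
    (r := r) (by rwa [Real.norm_of_nonneg h0.le])
  have h3 := ((summable_nat_add_iff 1).2 h2).mul_left ((m + 2 : ℝ) ^ m * r⁻¹)
  refine Summable.of_nonneg_of_le (fun k => by positivity) (fun k => ?_) h3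
  calc r ^ k * ‖gaussCoeff k • powVec b (2 * k + m)‖
      ≤ r ^ k * ((m + 2 : ℝ) * (k + 1)) ^ m :=
        mul_le_mul_of_nonneg_left (norm_gauss_term_le b m k) (by positivity)
    _ = _ := by
        push_cast
        rw [mul_pow, pow_succ]
        field_simp

theorem gaussVec_zero (b : HilbertBasis ℕ ℂ H) (m : ℕ) : gaussVec b m 0 = powVec b m := by
  rw [gaussVec, tsum_eq_single 0]
  · simp [gaussCoeff]
  · intro k hk
    simp [hk]

theorem inner_basis_powVec (b : HilbertBasis ℕ ℂ H) (m n : ℕ) :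
    ⟪b m, powVec b n⟫_ℂ = if m = n then (√(n.factorial) : ℂ) else 0 := by
  rw [powVec, inner_smul_right, orthonormal_iff_ite.1 b.orthonormal, mul_ite, mul_one, mul_zero]

theorem eq_zero_of_inner_basis (b : HilbertBasis ℕ ℂ H) {x : H} (h : ∀ n, ⟪b n, x⟫_ℂ = 0) :
    x = 0 := by
  have h1 := b.hasSum_repr x
  simp only [b.repr_apply_apply, h, zero_smul] at h1
  exact h1.unique hasSum_zero

variable [CompleteSpace H]

theorem hasSum_gaussVec (b : HilbertBasis ℕ ℂ H) (m : ℕ) {z : ℂ} (hz : ‖z‖ < 1) :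
    HasSum (fun k : ℕ => z ^ k • gaussCoeff k • powVec b (2 * k + m)) (gaussVec b m z) := by
  obtain ⟨r, hr, hr1⟩ := exists_between hz
  refine Summable.hasSum (.of_norm_bounded (summable_gauss_norm b m
    ((norm_nonneg z).trans_lt hr) hr1) fun k => ?_)
  rw [norm_smul, norm_pow]
  gcongr

theorem hasDerivAt_gaussVec (b : HilbertBasis ℕ ℂ H) (m : ℕ) {z : ℂ} (hz : ‖z‖ < 1) :
    HasDerivAt (gaussVec b m) ((-1 / 2 : ℂ) • gaussVec b (m + 2) z) z := by
  obtain ⟨r, hr, hr1⟩ := exists_between hz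
  have hr0 : 0 < r := (norm_nonneg z).trans_lt hr
  let v : ℕ → H := fun k => gaussCoeff k • powVec b (2 * k + m)
  have hv : ∀ k : ℕ, ((k + 1 : ℕ) : ℂ) • v (k + 1) =
      (-1 / 2 : ℂ) • gaussCoeff k • powVec b (2 * k + (m + 2)) := by
    intro k
    simp only [v]
    rw [smul_smul, smul_smul, ← succ_mul_gaussCoeff_succ]
    push_cast
    congr 2
    ring
  have hu : Summable fun k : ℕ => r ^ (k - 1) * ‖(k : ℂ) • v k‖ := by
    rw [← summable_nat_add_iff 1]
    refine ((summable_gauss_norm b (m + 2) hr0 hr1).mul_left (1 / 2)).congr fun k => ?_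
    rw [hv, norm_smul (-1 / 2 : ℂ), Nat.add_sub_cancel]
    norm_num
    ring
  have h1 := hasDerivAt_tsum_of_isPreconnected (t := Metric.ball (0 : ℂ) r)
    (g := fun k z => z ^ k • v k) (g' := fun k z => ((k : ℂ) * z ^ (k - 1)) • v k) (y₀ := z)
    (y := z) hu Metric.isOpen_ball (convex_ball _ _).isPreconnected
    (fun k y _ => (hasDerivAt_pow k y).smul_const (v k))
    (fun k y hy => by
      rw [mem_ball_zero_iff] at hy
      rw [mul_comm, mul_smul, norm_smul, norm_pow]
      gcongr)
    (mem_ball_zero_iff.2 hr) (hasSum_gaussVec b m hz).summable (mem_ball_zero_iff.2 hr)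
  have h2 : HasSum (fun k : ℕ => ((((k + 1 : ℕ) : ℂ)) * z ^ (k + 1 - 1)) • v (k + 1))
      ((-1 / 2 : ℂ) • gaussVec b (m + 2) z) := by
    refine ((hasSum_gaussVec b (m + 2) hz).const_smul (-1 / 2 : ℂ)).congr_fun ?_
    intro k
    rw [mul_comm, mul_smul, hv, Nat.add_sub_cancel, smul_comm]
  have h3 := (hasSum_nat_add_iff (f := fun k : ℕ => ((k : ℂ) * z ^ (k - 1)) • v k) 1).1 h2
  simp only [Finset.range_one, Finset.sum_singleton, Nat.cast_zero, zero_mul, zero_smul,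
    add_zero] at h3
  rw [← h3.tsum_eq]
  exact h1

theorem inner_basis_zero_gaussVec (b : HilbertBasis ℕ ℂ H) {z : ℂ} (hz : ‖z‖ < 1) :
    ⟪b 0, gaussVec b 0 z⟫_ℂ = 1 := by
  have h1 := (hasSum_gaussVec b 0 hz).mapL (innerSL ℂ (b 0))
  have h2 := hasSum_single (f := fun k : ℕ =>
    innerSL ℂ (b 0) (z ^ k • gaussCoeff k • powVec b (2 * k + 0))) 0 fun k hk => by
      rw [innerSL_apply_apply, inner_smul_right, inner_smul_right, inner_basis_powVec,
        if_neg (by omega), mul_zero, mul_zero]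
  have h3 := h1.unique h2
  rw [innerSL_apply_apply, innerSL_apply_apply] at h3
  rw [h3]
  simp [inner_basis_powVec, gaussCoeff]

variable {a : H →ₗ.[ℂ] H} {b : HilbertBasis ℕ ℂ H}

theorem sqrt_succ_mul_sqrt_factorial (n : ℕ) :
    (√(n + 1) : ℂ) * (√(n.factorial) : ℂ) = (√((n + 1).factorial) : ℂ) := by
  rw [← Complex.ofReal_mul, ← Real.sqrt_mul (by positivity), Nat.factorial_succ]
  push_cast
  rfl

theorem IsNumberBasis.powVec_mem_graph_adjoint (hb : IsNumberBasis a b) (n : ℕ) :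
    (powVec b n, powVec b (n + 1)) ∈ a.adjoint.graph := by
  rw [hb.adjoint_graph_iff]
  refine ⟨by simp [inner_basis_powVec], fun k => ?_⟩
  rw [inner_basis_powVec, inner_basis_powVec]
  rcases eq_or_ne k n with rfl | h
  · simp [sqrt_succ_mul_sqrt_factorial]
  · simp [h]

theorem IsNumberBasis.powVec_mem_graph (hb : IsNumberBasis a b) (n : ℕ) :
    (powVec b n, (n : ℂ) • powVec b (n - 1)) ∈ a.graph := by
  rw [hb.graph_iff]
  intro k
  rw [inner_smul_right, inner_basis_powVec, inner_basis_powVec]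
  cases n with
  | zero => simp
  | succ n =>
    rcases eq_or_ne k n with rfl | h
    · have h1 : (√(k + 1) : ℂ) * (√(k + 1) : ℂ) = k + 1 := by
        rw [← Complex.ofReal_mul, Real.mul_self_sqrt (by positivity)]
        push_cast
        rfl
      simp only [Nat.add_sub_cancel, if_true]
      rw [← sqrt_succ_mul_sqrt_factorial, ← mul_assoc, h1]
      push_cast
      rfl
    · simp [h]

/-- `a†` raises `m` by one. -/
theorem IsNumberBasis.gaussVec_mem_graph_adjoint (hb : IsNumberBasis a b)
    (hd : Dense (a.domain : Set H)) (m : ℕ) {z : ℂ} (hz : ‖z‖ < 1) :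
    (gaussVec b m z, gaussVec b (m + 1) z) ∈ a.adjoint.graph := by
  refine mem_graph_of_tendsto (LinearPMap.adjoint_isClosed hd)
    (hasSum_gaussVec b m hz).tendsto_sum_nat (hasSum_gaussVec b (m + 1) hz).tendsto_sum_nat
    fun N => ?_
  have h1 := Submodule.sum_mem (t := Finset.range N) a.adjoint.graph fun k _ =>
    a.adjoint.graph.smul_mem (z ^ k) (a.adjoint.graph.smul_mem (gaussCoeff k)
      (hb.powVec_mem_graph_adjoint (2 * k + m)))
  convert h1 using 1
  exact Prod.ext (by rw [Prod.fst_sum]; rfl) (by rw [Prod.snd_sum]; rfl)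

/-- `a a†ᵐ ψ = m a†ᵐ⁻¹ ψ - z a†ᵐ⁺¹ ψ` for the squeezed vector `ψ` with parameter `z`. The natural
subtraction `m - 1` is harmless, as the term carries the factor `m`. -/
theorem IsNumberBasis.gaussVec_mem_graph (hb : IsNumberBasis a b)
    (hc : a.IsClosed) (m : ℕ) {z : ℂ} (hz : ‖z‖ < 1) :
    (gaussVec b m z, (m : ℂ) • gaussVec b (m - 1) z - z • gaussVec b (m + 1) z) ∈ a.graph := by
  refine mem_graph_of_tendsto hc
    ((tendsto_add_atTop_iff_nat 1).2 (hasSum_gaussVec b m hz).tendsto_sum_nat)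
    ((((tendsto_add_atTop_iff_nat 1).2
      (hasSum_gaussVec b (m - 1) hz).tendsto_sum_nat).const_smul (m : ℂ)).sub
      ((hasSum_gaussVec b (m + 1) hz).tendsto_sum_nat.const_smul z)) fun N => ?_
  induction N with
  | zero =>
    simpa [gaussCoeff] using hb.powVec_mem_graph m
  | succ N ih =>
    have h1 := a.graph.smul_mem (z ^ (N + 1)) (a.graph.smul_mem (gaussCoeff (N + 1))
      (hb.powVec_mem_graph (2 * (N + 1) + m)))
    have h2 := a.graph.add_mem ih h1
    rw [Finset.sum_range_succ _ (N + 1)]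
    rw [Finset.sum_range_succ (fun k => z ^ k • gaussCoeff k • powVec b (2 * k + (m - 1))) (N + 1),
      Finset.sum_range_succ (fun k => z ^ k • gaussCoeff k • powVec b (2 * k + (m + 1))) N]
    convert h2 using 1
    rw [Prod.smul_mk, Prod.smul_mk, Prod.mk_add_mk]
    congr 1
    rw [show 2 * (N + 1) + m - 1 = 2 * N + (m + 1) by omega]
    have h3 := succ_mul_gaussCoeff_succ N
    have h4 : (m : ℂ) • powVec b (2 * (N + 1) + (m - 1)) =
        (m : ℂ) • powVec b (2 * N + (m + 1)) := by
      cases m with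
      | zero => simp
      | succ m =>
        congr 2
        omega
    rw [smul_add, smul_add, smul_comm (m : ℂ) (z ^ (N + 1)), smul_comm (m : ℂ) (gaussCoeff (N + 1)),
      h4]
    generalize gaussCoeff (N + 1) = c at h3 ⊢
    match_scalars
    all_goals try ring1
    linear_combination (-2) * z ^ (N + 1) * h3

end GaussianVectors

/-! ### The squeezed lines -/

section Lines

variable {H : Type*} [NormedAddCommGroup H] [InnerProductSpace ℂ H] [CompleteSpace H]
variable {a : H →ₗ.[ℂ] H} {b : HilbertBasis ℕ ℂ H}

/-- In a number basis, `(a + z a†) x = 0` becomes a two-term recursion. -/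
theorem IsNumberBasis.recursion (hb : IsNumberBasis a b) {z : ℂ} {x y w : H}
    (hy : (x, y) ∈ a.graph) (hw : (x, w) ∈ a.adjoint.graph) (h : y + z • w = 0) :
    ⟪b 1, x⟫_ℂ = 0 ∧ ∀ n : ℕ, √(n + 2) * ⟪b (n + 2), x⟫_ℂ = -z * (√(n + 1) * ⟪b n, x⟫_ℂ) := by
  rw [hb.graph_iff] at hy
  rw [hb.adjoint_graph_iff] at hw
  have h1 : ∀ n, ⟪b n, y⟫_ℂ + z * ⟪b n, w⟫_ℂ = 0 := fun n => by
    rw [← inner_smul_right, ← inner_add_right, h, inner_zero_right]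
  constructor
  · have := h1 0
    rw [hw.1, hy] at this
    simpa using this
  · intro n
    have h2 := h1 (n + 1)
    rw [hw.2, hy] at h2
    have h3 : ((n + 1 : ℕ) : ℝ) + 1 = n + 2 := by push_cast; ring
    rw [h3] at h2
    linear_combination h2

theorem IsNumberBasis.eq_zero_of_inner_zero (hb : IsNumberBasis a b) {z : ℂ} {x : H}
    (hx : x ∈ squeezedLine a z) (h0 : ⟪b 0, x⟫_ℂ = 0) : x = 0 := by
  obtain ⟨y, w, hy, hw, h⟩ := mem_squeezedLine.1 hx
  obtain ⟨h1, h2⟩ := hb.recursion hy hw h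
  have h3 : ∀ n, ⟪b n, x⟫_ℂ = 0 ∧ ⟪b (n + 1), x⟫_ℂ = 0 := by
    intro n
    induction n with
    | zero => exact ⟨h0, h1⟩
    | succ n ih =>
      refine ⟨ih.2, ?_⟩
      have h4 := h2 n
      rw [ih.1, mul_zero, mul_zero] at h4
      refine (mul_eq_zero.1 h4).resolve_left ?_
      have : (0 : ℝ) < √(n + 2) := Real.sqrt_pos.2 (by positivity)
      exact_mod_cast this.ne'
  exact eq_zero_of_inner_basis b fun n => (h3 n).1

theorem IsNumberBasis.gaussVec_mem_squeezedLine (hb : IsNumberBasis a b) (hc : a.IsClosed)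
    (hd : Dense (a.domain : Set H)) {z : ℂ} (hz : ‖z‖ < 1) :
    gaussVec b 0 z ∈ squeezedLine a z := by
  refine mem_squeezedLine.2 ⟨_, _, hb.gaussVec_mem_graph hc 0 hz,
    hb.gaussVec_mem_graph_adjoint hd 0 hz, ?_⟩
  simp

theorem IsNumberBasis.squeezedLine_eq_span (hb : IsNumberBasis a b) (hc : a.IsClosed)
    (hd : Dense (a.domain : Set H)) {z : ℂ} (hz : ‖z‖ < 1) :
    squeezedLine a z = Submodule.span ℂ {gaussVec b 0 z} := by
  have h1 := hb.gaussVec_mem_squeezedLine hc hd hz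
  refine le_antisymm (fun x hx => ?_) ((Submodule.span_singleton_le_iff_mem _ _).2 h1)
  refine Submodule.mem_span_singleton.2 ⟨⟪b 0, x⟫_ℂ, ?_⟩
  refine sub_eq_zero.1 (hb.eq_zero_of_inner_zero (z := z) ?_ ?_)
  · exact Submodule.sub_mem _ (Submodule.smul_mem _ _ h1) hx
  · rw [inner_sub_right, inner_smul_right, inner_basis_zero_gaussVec b hz, mul_one, sub_self]

theorem gaussVec_ne_zero (b : HilbertBasis ℕ ℂ H) {z : ℂ} (hz : ‖z‖ < 1) :
    gaussVec b 0 z ≠ 0 := by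
  intro h
  have := inner_basis_zero_gaussVec b hz
  rw [h, inner_zero_right] at this
  exact zero_ne_one this

/-- For `|z| ≥ 1` the recursion makes the coefficients of `a† x` bounded below unless `x = 0`. -/
theorem IsNumberBasis.squeezedLine_eq_bot (hb : IsNumberBasis a b) {z : ℂ} (hz : 1 ≤ ‖z‖) :
    squeezedLine a z = ⊥ := by
  refine (Submodule.eq_bot_iff _).2 fun x hx => ?_
  refine hb.eq_zero_of_inner_zero hx ?_
  obtain ⟨y, w, hy, hw, h⟩ := mem_squeezedLine.1 hx
  obtain ⟨-, h2⟩ := hb.recursion hy hw h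
  have h3 : ∀ k : ℕ, ‖⟪b 0, x⟫_ℂ‖ ^ 2 ≤ (2 * k + 1) * ‖⟪b (2 * k), x⟫_ℂ‖ ^ 2 := by
    intro k
    induction k with
    | zero => simp
    | succ k ih =>
      have h4 := congrArg (fun c : ℂ => ‖c‖ ^ 2) (h2 (2 * k))
      simp only [norm_mul, norm_neg, mul_pow, Complex.norm_real, Real.norm_eq_abs, sq_abs] at h4
      rw [Real.sq_sqrt (by positivity), Real.sq_sqrt (by positivity)] at h4
      push_cast at h4 ⊢
      have h5 : 1 ≤ ‖z‖ ^ 2 := one_le_pow₀ hz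
      rw [show 2 * (k + 1) = 2 * k + 2 by ring]
      have h6 := sq_nonneg ‖⟪b (2 * k + 2), x⟫_ℂ‖
      have h7 : (2 * (k : ℝ) + 1) * ‖⟪b (2 * k), x⟫_ℂ‖ ^ 2 ≤
          ‖z‖ ^ 2 * ((2 * (k : ℝ) + 1) * ‖⟪b (2 * k), x⟫_ℂ‖ ^ 2) :=
        le_mul_of_one_le_left (by positivity) h5
      nlinarith
  have h4 : Tendsto (fun k : ℕ => ‖⟪b (2 * k + 1), w⟫_ℂ‖ ^ 2) atTop (𝓝 0) :=
    (b.orthonormal.inner_products_summable w).tendsto_atTop_zero.comp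
      (tendsto_atTop_mono (fun k => show k ≤ 2 * k + 1 by omega) tendsto_id)
  have h5 : ‖⟪b 0, x⟫_ℂ‖ ^ 2 ≤ 0 := by
    refine ge_of_tendsto' h4 fun k => (h3 k).trans_eq ?_
    rw [((hb.adjoint_graph_iff _ _).1 hw).2, norm_mul, mul_pow, Complex.norm_real,
      Real.norm_eq_abs, sq_abs, Real.sq_sqrt (by positivity)]
    push_cast
    rfl
  exact norm_eq_zero.1 (pow_eq_zero_iff two_ne_zero |>.1 (le_antisymm h5 (sq_nonneg _)))

theorem IsNumberBasis.squeezedLine_injective (hb : IsNumberBasis a b) (hc : a.IsClosed)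
    (hd : Dense (a.domain : Set H)) : Function.Injective fun z : 𝔻 => squeezedLine a (z : ℂ) := by
  intro z z' hzz'
  have h1 := hb.gaussVec_mem_squeezedLine hc hd z.norm_lt_one
  have h2 := h1
  simp only at hzz'
  rw [hzz'] at h2
  obtain ⟨y, w, hy, hw, h⟩ := mem_squeezedLine.1 h1
  obtain ⟨y', w', hy', hw', h'⟩ := mem_squeezedLine.1 h2
  obtain rfl := a.mem_graph_snd_inj hy hy' rfl
  obtain rfl := a.adjoint.mem_graph_snd_inj hw hw' rfl
  by_contra hne
  have h3 : ((z : ℂ) - z') • w = 0 := by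
    rw [sub_smul, ← add_sub_add_left_eq_sub _ _ y, h, h', sub_zero]
  have h4 : w = 0 := (smul_eq_zero.1 h3).resolve_left
    (sub_ne_zero.2 fun h => hne (Complex.UnitDisc.coe_injective h))
  have h5 := ((hb.adjoint_graph_iff _ _).1 hw).2 0
  rw [h4, inner_zero_right, inner_basis_zero_gaussVec b z.norm_lt_one] at h5
  simp at h5

end Lines

/-! ### The quadratic Hamiltonian on squeezed vectors -/

section Dynamics

variable {H : Type*} [NormedAddCommGroup H] [InnerProductSpace ℂ H] [CompleteSpace H]
variable {a : H →ₗ.[ℂ] H} {b : HilbertBasis ℕ ℂ H} {ω : ℝ} {α : ℂ}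

theorem isSymm_hamiltonian (hd : Dense (a.domain : Set H)) : IsSymm (hamiltonian a ω α) := by
  intro x v x₂ v₂ hx hx₂
  obtain ⟨y, y', n, q, q', hy, hy', hn, hq, hq', rfl⟩ := mem_graph_hamiltonian.1 hx
  obtain ⟨y₂, y₂', n₂, q₂, q₂', hy₂, hy₂', hn₂, hq₂, hq₂', rfl⟩ := mem_graph_hamiltonian.1 hx₂
  have key : ∀ {u v x y : H}, (u, v) ∈ a.graph → (x, y) ∈ a.adjoint.graph →
      ⟪y, u⟫_ℂ = ⟪x, v⟫_ℂ := fun {u v x y} huv hxy => by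
    rw [← inner_conj_symm, inner_of_mem_graph hd huv hxy, inner_conj_symm]
  have h1 : ⟪n, x₂⟫_ℂ = ⟪x, n₂⟫_ℂ := by
    rw [key hy₂ hn, inner_of_mem_graph hd hy hn₂]
  have h2 : ⟪q, x₂⟫_ℂ = ⟪x, q₂'⟫_ℂ := by
    rw [inner_of_mem_graph hd hy hq₂', inner_of_mem_graph hd hq hy₂']
  have h3 : ⟪q', x₂⟫_ℂ = ⟪x, q₂⟫_ℂ := by
    rw [key hy₂ hq', key hq₂ hy']
  simp only [inner_add_left, inner_add_right, inner_smul_left, inner_smul_right, h1, h2, h3,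
    map_div₀, Complex.conj_conj, Complex.conj_ofReal, map_ofNat]
  ring

/-- The quadratic terms produced by the Hamiltonian combine to the right-hand side of the Riccati
equation. For `m ≤ 1` the term `m (m - 1) a†ᵐ⁻² ψ` of `a² a†ᵐ ψ` is absent. -/
theorem IsNumberBasis.gaussVec_mem_graph_hamiltonian (hb : IsNumberBasis a b) (hc : a.IsClosed)
    (hd : Dense (a.domain : Set H)) {m : ℕ} (hm : m = 0 ∨ m = 1) {z : ℂ} (hz : ‖z‖ < 1) :
    (gaussVec b m z, (m * ω - (2 * m + 1) * α * z / 2) • gaussVec b m z +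
      ((α * z ^ 2 - 2 * ω * z + conj α) / 2) • gaussVec b (m + 2) z) ∈
        (hamiltonian a ω α).graph := by
  have hA := fun m => hb.gaussVec_mem_graph hc m hz
  have hB := fun m => hb.gaussVec_mem_graph_adjoint hd m hz
  have hBA : ((m : ℂ) • gaussVec b (m - 1) z - z • gaussVec b (m + 1) z,
      (m : ℂ) • gaussVec b m z - z • gaussVec b (m + 2) z) ∈ a.adjoint.graph := by
    have h1 : ((m : ℂ) • gaussVec b (m - 1) z, (m : ℂ) • gaussVec b m z) ∈ a.adjoint.graph := by
      rcases hm with rfl | rfl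
      · simp
      · exact a.adjoint.graph.smul_mem _ (hB 0)
    exact a.adjoint.graph.sub_mem h1 (a.adjoint.graph.smul_mem z (hB (m + 1)))
  have hAA : ((m : ℂ) • gaussVec b (m - 1) z - z • gaussVec b (m + 1) z,
      (-(2 * m + 1) * z) • gaussVec b m z + z ^ 2 • gaussVec b (m + 2) z) ∈ a.graph := by
    have := a.graph.sub_mem (a.graph.smul_mem (m : ℂ) (hA (m - 1)))
      (a.graph.smul_mem z (hA (m + 1)))
    convert this using 1
    rw [Prod.smul_mk, Prod.smul_mk, Prod.mk_sub_mk]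
    congr 1
    rcases hm with rfl | rfl
    · simp only [Nat.add_sub_cancel]
      push_cast
      module
    · simp only [Nat.add_sub_cancel, Nat.sub_self, Nat.zero_add]
      push_cast
      module
  refine mem_graph_hamiltonian.2 ⟨_, _, _, _, _, hA m, hB m, hBA, hAA, hB (m + 1), ?_⟩
  module

/-- If `ζ` solves the Riccati equation, then a suitable multiple of `a†ᵐ exp (-ζ(t) a†² / 2) Ω`
with `m ≤ 1` solves the Schrödinger equation. -/
theorem IsNumberBasis.exists_isSolution (hb : IsNumberBasis a b) (hc : a.IsClosed)
    (hd : Dense (a.domain : Set H)) {m : ℕ} (hm : m = 0 ∨ m = 1) {ζ : ℝ → ℂ}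
    (hζ : ∀ t, ‖ζ t‖ < 1)
    (hζ' : ∀ t, HasDerivAt ζ (Complex.I * (α * ζ t ^ 2 - 2 * ω * ζ t + conj α)) t) :
    ∃ c : ℝ → ℂ, c 0 = 1 ∧ (∀ t, c t ≠ 0) ∧
      IsSolution (hamiltonian a ω α) fun t => c t • gaussVec b m (ζ t) := by
  have hcont : Continuous ζ := continuous_iff_continuousAt.2 fun t => (hζ' t).continuousAt
  let g : ℝ → ℂ := fun t => -Complex.I * (m * ω - (2 * m + 1) * α * ζ t / 2)
  have hg : Continuous g := by fun_prop
  refine ⟨fun t => Complex.exp (∫ s in (0 : ℝ)..t, g s), by simp, fun t => Complex.exp_ne_zero _,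
    fun t => ⟨_, (hamiltonian a ω α).graph.smul_mem _
      (hb.gaussVec_mem_graph_hamiltonian hc hd hm (hζ t)), ?_⟩⟩
  have h1 := (hg.integral_hasStrictDerivAt 0 t).hasDerivAt.cexp
  have h2 := (hasDerivAt_gaussVec b m (hζ t)).scomp t (hζ' t)
  refine (h1.smul h2).congr_deriv ?_
  simp only [g, Function.comp_apply]
  module

/-- If the Riccati equation has global solutions in the disk, the Schrödinger equation has a total
set of classical solutions: the closed span of the vectors with `m = 0` contains the even number
states, that of the vectors with `m = 1` the odd ones. -/
theorem IsNumberBasis.dense_solutionSpace (hb : IsNumberBasis a b) (hc : a.IsClosed)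
    (hd : Dense (a.domain : Set H))
    (h : ∀ z : ℂ, ‖z‖ < 1 → ∃ ζ : ℝ → ℂ, ζ 0 = z ∧ (∀ t, ‖ζ t‖ < 1) ∧
      ∀ t, HasDerivAt ζ (Complex.I * (α * ζ t ^ 2 - 2 * ω * ζ t + conj α)) t) :
    Dense (solutionSpace (hamiltonian a ω α) : Set H) := by
  have hmem : ∀ m : ℕ, m = 0 ∨ m = 1 → ∀ z : ℂ, ‖z‖ < 1 →
      gaussVec b m z ∈ solutionSpace (hamiltonian a ω α) := by
    intro m hm z hz
    obtain ⟨ζ, rfl, h1, h2⟩ := h z hz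
    obtain ⟨c, hc0, -, hs⟩ := hb.exists_isSolution hc hd hm h1 h2
    have := hs.mem_solutionSpace 0
    simpa [hc0] using this
  rw [Submodule.dense_iff_topologicalClosure_eq_top,
    Submodule.topologicalClosure_eq_top_iff, Submodule.eq_bot_iff]
  intro x hx
  rw [Submodule.mem_orthogonal'] at hx
  -- differentiating `⟪x, gaussVec b m z⟫ = 0` raises `m` by two
  have h1 : ∀ m : ℕ, (∀ z : ℂ, ‖z‖ < 1 → ⟪x, gaussVec b m z⟫_ℂ = 0) →
      ∀ z : ℂ, ‖z‖ < 1 → ⟪x, gaussVec b (m + 2) z⟫_ℂ = 0 := by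
    intro m hm z hz
    have h2 := (innerSL ℂ x).hasFDerivAt.comp_hasDerivAt z (hasDerivAt_gaussVec b m hz)
    have h3 : HasDerivAt (innerSL ℂ x ∘ gaussVec b m) 0 z := by
      refine (hasDerivAt_const z (0 : ℂ)).congr_of_eventuallyEq ?_
      filter_upwards [(isOpen_lt continuous_norm continuous_const).mem_nhds hz] with y hy
      exact hm y hy
    have h4 := h2.unique h3
    rw [map_smul, innerSL_apply_apply, smul_eq_zero] at h4
    exact h4.resolve_left (by norm_num)
  have h2 : ∀ m : ℕ, (∀ z : ℂ, ‖z‖ < 1 → ⟪x, gaussVec b m z⟫_ℂ = 0) ∧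
      ∀ z : ℂ, ‖z‖ < 1 → ⟪x, gaussVec b (m + 1) z⟫_ℂ = 0 := by
    intro m
    induction m with
    | zero => exact ⟨fun z hz => hx _ (hmem 0 (.inl rfl) z hz),
        fun z hz => hx _ (hmem 1 (.inr rfl) z hz)⟩
    | succ m ih => exact ⟨ih.2, h1 m ih.1⟩
  refine eq_zero_of_inner_basis b fun n => ?_
  have h3 := (h2 n).1 0 (by simp)
  rw [gaussVec_zero, powVec, inner_smul_right] at h3
  have h4 : ⟪x, b n⟫_ℂ = 0 := by
    refine (mul_eq_zero.1 h3).resolve_left ?_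
    have : (0 : ℝ) < √(n.factorial) := Real.sqrt_pos.2 (by exact_mod_cast n.factorial_pos)
    exact_mod_cast this.ne'
  rw [← inner_conj_symm, h4, map_zero]

end Dynamics

/-! ### The Möbius flow of the Riccati equation -/

section Flow

/-- `C` and `S` are the solutions of `y'' = κ y` with `C(0) = 1`, `C'(0) = 0` and `S(0) = 0`,
`S'(0) = 1`; they are trigonometric, polynomial or hyperbolic according to the sign of `κ`. The
addition theorems and the Pythagorean identity are included in the structure. -/
structure IsTrigPair (κ : ℝ) (C S : ℝ → ℝ) : Prop where
  C_zero : C 0 = 1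
  S_zero : S 0 = 0
  C_deriv : ∀ t, HasDerivAt C (κ * S t) t
  S_deriv : ∀ t, HasDerivAt S (C t) t
  C_add : ∀ s t, C (s + t) = C s * C t + κ * (S s * S t)
  S_add : ∀ s t, S (s + t) = S s * C t + C s * S t
  sq_sub : ∀ t, C t ^ 2 - κ * S t ^ 2 = 1

theorem exists_isTrigPair (κ : ℝ) : ∃ C S : ℝ → ℝ, IsTrigPair κ C S := by
  have hlin : ∀ m t : ℝ, HasDerivAt (fun t => m * t) m t := fun m t => by
    simpa using (hasDerivAt_id t).const_mul m
  rcases lt_trichotomy κ 0 with h | rfl | h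
  · obtain ⟨m, hm, rfl⟩ : ∃ m : ℝ, m ≠ 0 ∧ κ = -m ^ 2 :=
      ⟨√(-κ), (Real.sqrt_pos.2 (by linarith)).ne', by rw [Real.sq_sqrt (by linarith)]; ring⟩
    refine ⟨fun t => Real.cos (m * t), fun t => Real.sin (m * t) / m, by simp, by simp,
      fun t => ?_, fun t => ?_, fun s t => ?_, fun s t => ?_, fun t => ?_⟩
    · exact (hlin m t).cos.congr_deriv (by field_simp)
    · exact ((hlin m t).sin.div_const m).congr_deriv (by field_simp)
    · rw [mul_add, Real.cos_add]
      field_simp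
      ring
    · rw [mul_add, Real.sin_add]
      field_simp
    · rw [div_pow, ← Real.cos_sq_add_sin_sq (m * t)]
      field_simp
      ring
  · refine ⟨fun t => 1, fun t => t, rfl, rfl, fun t => ?_, fun t => hasDerivAt_id t,
      fun s t => by ring, fun s t => by ring, fun t => by ring⟩
    simpa using hasDerivAt_const t (1 : ℝ)
  · obtain ⟨m, hm, rfl⟩ : ∃ m : ℝ, m ≠ 0 ∧ κ = m ^ 2 :=
      ⟨√κ, (Real.sqrt_pos.2 h).ne', (Real.sq_sqrt h.le).symm⟩
    refine ⟨fun t => Real.cosh (m * t), fun t => Real.sinh (m * t) / m, by simp, by simp,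
      fun t => ?_, fun t => ?_, fun s t => ?_, fun s t => ?_, fun t => ?_⟩
    · exact (hlin m t).cosh.congr_deriv (by field_simp)
    · exact ((hlin m t).sinh.div_const m).congr_deriv (by field_simp)
    · rw [mul_add, Real.cosh_add]
      field_simp
    · rw [mul_add, Real.sinh_add]
      field_simp
    · rw [div_pow, ← Real.cosh_sq_sub_sinh_sq (m * t)]
      field_simp

/-- Euler's formula: for `l ^ 2 = -κ` the multiplier `C - i l S` of the flow at a fixed point is an
exponential. -/
theorem IsTrigPair.sub_eq_exp {κ : ℝ} {C S : ℝ → ℝ} (h : IsTrigPair κ C S) {l : ℂ}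
    (hl : l ^ 2 = -κ) (t : ℝ) :
    (C t : ℂ) - Complex.I * l * S t = Complex.exp (-Complex.I * l * t) := by
  have h1 : ∀ t : ℝ, HasDerivAt (fun t : ℝ => ((C t : ℂ) - Complex.I * l * S t) *
      Complex.exp (Complex.I * l * t)) 0 t := by
    intro t
    have h2 := (h.C_deriv t).ofReal_comp.sub ((h.S_deriv t).ofReal_comp.const_mul (Complex.I * l))
    have h3 : HasDerivAt (fun t : ℝ => Complex.I * l * (t : ℂ)) (Complex.I * l) t := by
      simpa using (hasDerivAt_id t).ofReal_comp.const_mul (Complex.I * l)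
    refine (h2.mul h3.cexp).congr_deriv ?_
    simp only [Pi.sub_apply]
    push_cast
    have := Complex.I_sq
    linear_combination (-(S t : ℂ) * Complex.exp (Complex.I * l * t)) * (l ^ 2 * this - hl)
  have h2 := is_const_of_deriv_eq_zero (fun t => (h1 t).differentiableAt) (fun t => (h1 t).deriv)
    t 0
  simp only [h.C_zero, h.S_zero, Complex.ofReal_zero, Complex.ofReal_one, mul_zero, sub_zero,
    Complex.exp_zero, mul_one] at h2
  rw [neg_mul, neg_mul, Complex.exp_neg]
  exact eq_inv_of_mul_eq_one_left h2

variable (ω : ℝ) (α : ℂ)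

/-- The numerator `u z + v` of the flow, with `u = c - i ω s` and `v = i ᾱ s`. -/
noncomputable def flowNum (c s : ℝ) (z : ℂ) : ℂ :=
  (c - Complex.I * ω * s) * z + Complex.I * conj α * s

/-- The denominator `v̄ z + ū` of the flow, with `u = c - i ω s` and `v = i ᾱ s`. -/
noncomputable def flowDen (c s : ℝ) (z : ℂ) : ℂ :=
  conj (Complex.I * conj α * s) * z + conj (c - Complex.I * ω * s : ℂ)

theorem flowDen_eq (c s : ℝ) (z : ℂ) :
    flowDen ω α c s z = -Complex.I * α * s * z + (c + Complex.I * ω * s) := by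
  simp [flowDen]

variable {ω α}

theorem conj_mul_self_eq (α : ℂ) : conj α * α = (‖α‖ : ℂ) ^ 2 := by
  rw [mul_comm, Complex.mul_conj']

theorem norm_flowDen_sq {c s : ℝ} (h : c ^ 2 - (‖α‖ ^ 2 - ω ^ 2) * s ^ 2 = 1) (z : ℂ) :
    ‖flowDen ω α c s z‖ ^ 2 = ‖flowNum ω α c s z‖ ^ 2 + (1 - ‖z‖ ^ 2) := by
  have h' : (c : ℂ) ^ 2 - ((‖α‖ : ℂ) ^ 2 - ω ^ 2) * s ^ 2 = 1 := by exact_mod_cast h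
  have h1 : ((‖flowDen ω α c s z‖ ^ 2 : ℝ) : ℂ) =
      ((‖flowNum ω α c s z‖ ^ 2 + (1 - ‖z‖ ^ 2) : ℝ) : ℂ) := by
    push_cast
    rw [← Complex.mul_conj', ← Complex.mul_conj', ← Complex.mul_conj', flowDen_eq, flowNum]
    simp only [map_add, map_mul, map_sub, Complex.conj_I, Complex.conj_ofReal, Complex.conj_conj,
      map_neg, neg_neg]
    linear_combination (1 - z * conj z) * h' - (1 - z * conj z) * s ^ 2 * conj_mul_self_eq α
      + (z * conj z - 1) * (ω ^ 2 - conj α * α) * s ^ 2 * Complex.I_sq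
  exact_mod_cast h1

theorem norm_flowNum_lt {c s : ℝ} (h : c ^ 2 - (‖α‖ ^ 2 - ω ^ 2) * s ^ 2 = 1) {z : ℂ}
    (hz : ‖z‖ < 1) : ‖flowNum ω α c s z‖ < ‖flowDen ω α c s z‖ := by
  have h1 := norm_flowDen_sq h z
  have h2 : ‖z‖ ^ 2 < 1 := pow_lt_one₀ (norm_nonneg z) hz two_ne_zero
  exact lt_of_pow_lt_pow_left₀ 2 (norm_nonneg _) (by linarith)

theorem flowDen_ne_zero {c s : ℝ} (h : c ^ 2 - (‖α‖ ^ 2 - ω ^ 2) * s ^ 2 = 1) {z : ℂ}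
    (hz : ‖z‖ < 1) : flowDen ω α c s z ≠ 0 :=
  norm_pos_iff.1 ((norm_nonneg _).trans_lt (norm_flowNum_lt h hz))

variable {C S : ℝ → ℝ}

/-- The Möbius flow `z ↦ (u z + v) / (v̄ z + ū)` of the unit disk, where
`u = C(t) - i ω S(t)` and `v = i ᾱ S(t)`. -/
noncomputable def discFlow (h : IsTrigPair (‖α‖ ^ 2 - ω ^ 2) C S) (t : ℝ) (z : 𝔻) : 𝔻 :=
  .mk (flowNum ω α (C t) (S t) z / flowDen ω α (C t) (S t) z) (by
    have h1 := norm_flowNum_lt (h.sq_sub t) z.norm_lt_one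
    rw [norm_div]
    exact (div_lt_one ((norm_nonneg _).trans_lt h1)).2 h1)

theorem coe_discFlow (h : IsTrigPair (‖α‖ ^ 2 - ω ^ 2) C S) (t : ℝ) (z : 𝔻) :
    (discFlow h t z : ℂ) = flowNum ω α (C t) (S t) z / flowDen ω α (C t) (S t) z := rfl

theorem discFlow_zero (h : IsTrigPair (‖α‖ ^ 2 - ω ^ 2) C S) (z : 𝔻) : discFlow h 0 z = z := by
  refine Complex.UnitDisc.coe_injective ?_
  rw [coe_discFlow, h.C_zero, h.S_zero, flowDen_eq, flowNum]
  simp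

/-- The flow solves the Riccati equation `z' = i (α z² - 2 ω z + ᾱ)`. -/
theorem hasDerivAt_discFlow (h : IsTrigPair (‖α‖ ^ 2 - ω ^ 2) C S) (z : 𝔻) (t : ℝ) :
    HasDerivAt (fun t => (discFlow h t z : ℂ)) (Complex.I * (α * (discFlow h t z : ℂ) ^ 2 -
      2 * ω * (discFlow h t z : ℂ) + conj α)) t := by
  have hD := flowDen_ne_zero (h.sq_sub t) z.norm_lt_one
  have hC := (h.C_deriv t).ofReal_comp
  have hS := (h.S_deriv t).ofReal_comp
  have hN' : HasDerivAt (fun t => flowNum ω α (C t) (S t) z)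
      (-Complex.I * ω * flowNum ω α (C t) (S t) z +
        Complex.I * conj α * flowDen ω α (C t) (S t) z) t := by
    refine (((hC.sub (hS.const_mul (Complex.I * ω))).mul_const (z : ℂ)).add
      (hS.const_mul (Complex.I * conj α))).congr_deriv ?_
    rw [flowDen_eq, flowNum]
    push_cast
    linear_combination (ω ^ 2 - conj α * α) * z * S t * -Complex.I_sq
      - z * S t * conj_mul_self_eq α
  have hD' : HasDerivAt (fun t => flowDen ω α (C t) (S t) z)
      (-Complex.I * α * flowNum ω α (C t) (S t) z +
        Complex.I * ω * flowDen ω α (C t) (S t) z) t := by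
    simp only [flowDen_eq]
    refine (((hS.const_mul (-Complex.I * α)).mul_const (z : ℂ)).add
      (hC.add (hS.const_mul (Complex.I * ω)))).congr_deriv ?_
    rw [flowNum]
    push_cast
    linear_combination (ω ^ 2 - conj α * α) * S t * -Complex.I_sq
      - S t * conj_mul_self_eq α
  simp only [coe_discFlow]
  refine (hN'.div hD' hD).congr_deriv ?_
  field_simp
  ring

theorem isMobiusFlow_discFlow (h : IsTrigPair (‖α‖ ^ 2 - ω ^ 2) C S) :
    IsMobiusFlow (discFlow h) := by
  refine ⟨discFlow_zero h, fun s t z => ?_, fun z => ?_, fun t => ?_⟩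
  · refine Complex.UnitDisc.coe_injective ?_
    have h3 := flowDen_ne_zero (h.sq_sub t) z.norm_lt_one
    have h4 : flowNum ω α (C (s + t)) (S (s + t)) z = flowNum ω α (C s) (S s) (discFlow h t z) *
        flowDen ω α (C t) (S t) z := by
      rw [coe_discFlow, flowNum, flowNum, add_mul, mul_assoc _ (_ / _),
        div_mul_cancel₀ _ h3, flowDen_eq, flowNum, h.C_add, h.S_add]
      push_cast
      linear_combination (ω ^ 2 - conj α * α) * z * S s * S t * -Complex.I_sq
        - z * S s * S t * conj_mul_self_eq α
    have h5 : flowDen ω α (C (s + t)) (S (s + t)) z = flowDen ω α (C s) (S s) (discFlow h t z) *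
        flowDen ω α (C t) (S t) z := by
      rw [coe_discFlow, flowDen_eq, flowDen_eq _ _ (C s), add_mul, mul_assoc _ (_ / _),
        div_mul_cancel₀ _ h3, flowDen_eq, flowNum, h.C_add, h.S_add]
      push_cast
      linear_combination (ω ^ 2 - conj α * α) * S s * S t * -Complex.I_sq
        - S s * S t * conj_mul_self_eq α
    rw [coe_discFlow h s, coe_discFlow h (s + t), h4, h5, mul_div_mul_right _ _ h3]
  · rw [Complex.UnitDisc.isEmbedding_coe.continuous_iff]
    exact continuous_iff_continuousAt.2 fun t => (hasDerivAt_discFlow h z t).continuousAt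
  · refine ⟨C t - Complex.I * ω * S t, Complex.I * conj α * S t, ?_, fun z => rfl⟩
    have h1 := norm_flowNum_lt (ω := ω) (α := α) (h.sq_sub t) (z := 0) (by simp)
    rwa [flowNum, flowDen, mul_zero, mul_zero, zero_add, zero_add, RCLike.norm_conj] at h1

/-- At a fixed point `ξ` of the flow, `M(t) z - ξ` is a multiple of `(z - ξ) / (v̄ z + ū)`. -/
theorem flowNum_sub {ξ l : ℂ} (h1 : α * ξ = ω - l) (h2 : conj α = (ω + l) * ξ) (c s : ℝ) (z : ℂ) :
    flowNum ω α c s z - ξ * flowDen ω α c s z = (c - Complex.I * l * s) * (z - ξ) := by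
  rw [flowDen_eq, flowNum]
  linear_combination Complex.I * s * z * h1 + Complex.I * s * h2

/-- The companion of `flowNum_sub` at the reflected point `1 / ξ̄`, for real `l`. -/
theorem flowDen_sub {ξ : ℂ} {l : ℝ} (h1 : α * ξ = ω - l) (h2 : conj α = (ω + l) * ξ) (c s : ℝ)
    (z : ℂ) : flowDen ω α c s z - conj ξ * flowNum ω α c s z =
      (c + Complex.I * l * s) * (1 - conj ξ * z) := by
  have h1' := congrArg conj h1
  have h2' := congrArg conj h2
  simp only [map_mul, map_sub, map_add, Complex.conj_ofReal, Complex.conj_conj] at h1' h2'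
  rw [flowDen_eq, flowNum]
  linear_combination -Complex.I * s * z * h2' - Complex.I * s * h1'

end Flow

/-! ### The fixed points of the flow -/

section FixedPoints

variable {ω : ℝ} {α : ℂ}

/-- `λ² = ω² - |α|²` with either branch of the definition of `λ`. -/
theorem lam_sq (h0 : 0 ≤ ω) : lam ω α ^ 2 = ω ^ 2 - (‖α‖ : ℂ) ^ 2 := by
  unfold lam
  split_ifs with h
  · rw [← Complex.ofReal_pow, Real.sq_sqrt (by nlinarith [norm_nonneg α])]
    push_cast
    rfl
  · rw [mul_pow, Complex.I_sq, ← Complex.ofReal_pow, Real.sq_sqrt (by nlinarith [norm_nonneg α])]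
    push_cast
    ring

theorem xiMinus_spec (h0 : 0 ≤ ω) (hα : α ≠ 0) : α * xiMinus ω α = ω - lam ω α ∧
    conj α = (ω + lam ω α) * xiMinus ω α := by
  have h1 : α * xiMinus ω α = ω - lam ω α := mul_div_cancel₀ _ hα
  refine ⟨h1, mul_left_cancel₀ hα ?_⟩
  have h2 := lam_sq (α := α) h0
  linear_combination conj_mul_self_eq α - (ω + lam ω α) * h1 + h2

theorem xiPlus_spec (h0 : 0 ≤ ω) (hα : α ≠ 0) : α * xiPlus ω α = ω - -lam ω α ∧
    conj α = (ω + -lam ω α) * xiPlus ω α := by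
  have h1 : α * xiPlus ω α = ω - -lam ω α := by
    rw [sub_neg_eq_add]
    exact mul_div_cancel₀ _ hα
  refine ⟨h1, mul_left_cancel₀ hα ?_⟩
  have h2 := lam_sq (α := α) h0
  linear_combination conj_mul_self_eq α - (ω - lam ω α) * h1 + h2

end FixedPoints

/-! ### The stable case -/

section Stable

variable {ω : ℝ} {α : ℂ} {C S : ℝ → ℝ}

theorem normSq_conj_mul_sub_one (c w : ℂ) :
    ‖conj c * w - 1‖ ^ 2 = ‖c - w‖ ^ 2 + (1 - ‖c‖ ^ 2) * (1 - ‖w‖ ^ 2) := by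
  have h1 : ((‖conj c * w - 1‖ ^ 2 : ℝ) : ℂ) =
      ((‖c - w‖ ^ 2 + (1 - ‖c‖ ^ 2) * (1 - ‖w‖ ^ 2) : ℝ) : ℂ) := by
    push_cast
    simp only [← Complex.mul_conj', map_sub, map_mul, map_one, Complex.conj_conj]
    ring
  exact_mod_cast h1

theorem norm_sub_lt {c w : ℂ} (hc : ‖c‖ < 1) (hw : ‖w‖ < 1) : ‖c - w‖ < ‖conj c * w - 1‖ := by
  have h1 := normSq_conj_mul_sub_one c w
  have h2 : ‖w‖ ^ 2 < 1 := pow_lt_one₀ (norm_nonneg w) hw two_ne_zero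
  have h3 : ‖c‖ ^ 2 < 1 := pow_lt_one₀ (norm_nonneg c) hc two_ne_zero
  exact lt_of_pow_lt_pow_left₀ 2 (norm_nonneg _) (by nlinarith)

/-- The hyperbolic distance is an injective function of `|c - w| / |c̄ w - 1|`. -/
theorem hdist_eq_iff {c w z : ℂ} (hc : ‖c‖ < 1) (hw : ‖w‖ < 1) (hz : ‖z‖ < 1) :
    hdist c w = hdist c z ↔ ‖c - w‖ * ‖conj c * z - 1‖ = ‖c - z‖ * ‖conj c * w - 1‖ := by
  have h1 := norm_sub_lt hc hw
  have h2 := norm_sub_lt hc hz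
  have h3 := norm_nonneg (c - w)
  have h4 := norm_nonneg (c - z)
  have h5 : 0 < (‖conj c * w - 1‖ + ‖c - w‖) / (‖conj c * w - 1‖ - ‖c - w‖) :=
    div_pos (by linarith) (by linarith)
  have h6 : 0 < (‖conj c * z - 1‖ + ‖c - z‖) / (‖conj c * z - 1‖ - ‖c - z‖) :=
    div_pos (by linarith) (by linarith)
  rw [hdist, hdist, Real.log_injOn_pos.eq_iff h5 h6, div_eq_div_iff (by linarith) (by linarith)]
  constructor <;> intro h <;> linarith

/-- In the coordinate `(x - ξ₋) / (1 - ξ̄₋ x)` the flow is the rotation by `exp (-2 i λ t)`, and the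
hyperbolic distance to `ξ₋` is a function of the absolute value. -/
theorem stable_case (hω : ‖α‖ < ω) (h : IsTrigPair (‖α‖ ^ 2 - ω ^ 2) C S) :
    ‖xiMinus ω α‖ < 1 ∧ ∀ z : 𝔻,
      orbit (discFlow h) z = hypCircle (xiMinus ω α) (hdist (xiMinus ω α) z) ∧
      ((z : ℂ) ≠ xiMinus ω α →
        Clockwise (fun t => (discFlow h t z : ℂ)) (xiMinus ω α)) := by
  have hω0 : 0 < ω := (norm_nonneg α).trans_lt hω
  have hpos : 0 < ω ^ 2 - ‖α‖ ^ 2 := by nlinarith [norm_nonneg α]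
  obtain ⟨l, hl, hl0, hl2⟩ : ∃ l : ℝ, lam ω α = l ∧ 0 < l ∧ l ^ 2 = ω ^ 2 - ‖α‖ ^ 2 :=
    ⟨√(ω ^ 2 - ‖α‖ ^ 2), by rw [lam, if_pos hω.le], Real.sqrt_pos.2 hpos, Real.sq_sqrt hpos.le⟩
  have hspec : α * xiMinus ω α = ω - l ∧ conj α = (ω + l) * xiMinus ω α := by
    rcases eq_or_ne α 0 with rfl | hα
    · have : l = ω := by
        rw [norm_zero] at hl2
        exact (pow_left_inj₀ hl0.le hω0.le two_ne_zero).1 (by linarith)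
      simp [xiMinus, this]
    · rw [← hl]
      exact xiMinus_spec hω0.le hα
  generalize xiMinus ω α = ξ at hspec ⊢
  obtain ⟨h1, h2⟩ := hspec
  have hξ : ‖ξ‖ < 1 := by
    have h3 := congrArg norm h2
    rw [RCLike.norm_conj, norm_mul, ← Complex.ofReal_add, Complex.norm_real,
      Real.norm_of_nonneg (by linarith)] at h3
    by_contra! h4
    nlinarith
  have hfac : ∀ z : ℂ, α * z ^ 2 - 2 * ω * z + conj α = (z - ξ) * (α * z - (ω + l)) := by
    intro z
    linear_combination h2 + z * h1
  have hexp : ∀ t : ℝ, (C t : ℂ) - Complex.I * l * S t =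
      Complex.exp (-(l * t : ℝ) * Complex.I) := by
    intro t
    rw [h.sub_eq_exp (l := l) (by rw [← Complex.ofReal_pow, hl2]; push_cast; ring)]
    congr 1
    push_cast
    ring
  have hexp' : ∀ t : ℝ, (C t : ℂ) + Complex.I * l * S t =
      Complex.exp ((l * t : ℝ) * Complex.I) := by
    intro t
    have h3 := congrArg conj (hexp t)
    rw [← Complex.exp_conj] at h3
    simpa using h3
  have hN : ∀ (t : ℝ) (z : 𝔻), ((discFlow h t z : ℂ) - ξ) * flowDen ω α (C t) (S t) z =
      Complex.exp (-(l * t : ℝ) * Complex.I) * (z - ξ) := by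
    intro t z
    rw [← hexp, ← flowNum_sub h1 h2, coe_discFlow, sub_mul,
      div_mul_cancel₀ _ (flowDen_ne_zero (h.sq_sub t) z.norm_lt_one)]
  have hD : ∀ (t : ℝ) (z : 𝔻), (1 - conj ξ * (discFlow h t z : ℂ)) *
      flowDen ω α (C t) (S t) z = Complex.exp ((l * t : ℝ) * Complex.I) * (1 - conj ξ * z) := by
    intro t z
    rw [← hexp', ← flowDen_sub h1 h2, coe_discFlow, sub_mul, one_mul, mul_assoc,
      div_mul_cancel₀ _ (flowDen_ne_zero (h.sq_sub t) z.norm_lt_one)]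
  have hne : ∀ z : 𝔻, 1 - conj ξ * (z : ℂ) ≠ 0 := by
    intro z h0
    have := norm_sub_lt hξ z.norm_lt_one
    rw [show conj ξ * (z : ℂ) - 1 = 0 by linear_combination -h0, norm_zero] at this
    exact this.not_ge (norm_nonneg _)
  refine ⟨hξ, fun z => ⟨?_, fun hzξ t => ?_⟩⟩
  · ext w
    constructor
    · rintro ⟨t, rfl⟩
      refine ⟨(discFlow h t z).norm_lt_one, ?_⟩
      simp only
      rw [hdist_eq_iff hξ (discFlow h t z).norm_lt_one z.norm_lt_one]
      have h3 := congrArg norm (hN t z)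
      have h4 := congrArg norm (hD t z)
      rw [norm_mul, norm_mul, neg_mul, ← neg_mul, ← Complex.ofReal_neg,
        Complex.norm_exp_ofReal_mul_I, one_mul] at h3
      rw [norm_mul, norm_mul, Complex.norm_exp_ofReal_mul_I, one_mul] at h4
      have h5 := norm_pos_iff.2 (flowDen_ne_zero (h.sq_sub t) z.norm_lt_one)
      rw [norm_sub_rev ξ, norm_sub_rev ξ, norm_sub_rev _ 1, norm_sub_rev _ 1, ← h3, ← h4]
      ring
    · rintro ⟨hw, hd⟩
      obtain ⟨w, rfl⟩ : ∃ w' : 𝔻, (w' : ℂ) = w := ⟨.mk w hw, rfl⟩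
      rw [hdist_eq_iff hξ hw z.norm_lt_one, norm_sub_rev ξ, norm_sub_rev ξ, norm_sub_rev _ 1,
        norm_sub_rev _ 1] at hd
      rcases eq_or_ne (z : ℂ) ξ with hz | hz
      · have hz1 := norm_ne_zero_iff.2 (hne z)
        rw [hz] at hz1
        rw [hz, sub_self, norm_zero, zero_mul] at hd
        have h3 := (mul_eq_zero.1 hd).resolve_right hz1
        refine ⟨0, ?_⟩
        simp only
        rw [discFlow_zero, hz]
        exact (sub_eq_zero.1 (norm_eq_zero.1 h3)).symm
      · -- `w` and `z` differ by a rotation in the coordinate `(x - ξ) / (1 - ξ̄ x)`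
        have hzξ : (z : ℂ) - ξ ≠ 0 := sub_ne_zero.2 hz
        set q : ℂ := ((w : ℂ) - ξ) * (1 - conj ξ * z) / (((z : ℂ) - ξ) * (1 - conj ξ * w)) with hq
        have hq1 : ‖q‖ = 1 := by
          rw [hq, norm_div, norm_mul, norm_mul, hd]
          exact div_self (mul_ne_zero (norm_ne_zero_iff.2 hzξ) (norm_ne_zero_iff.2 (hne w)))
        have hqe : q * (((z : ℂ) - ξ) * (1 - conj ξ * w)) = ((w : ℂ) - ξ) * (1 - conj ξ * z) :=
          div_mul_cancel₀ _ (mul_ne_zero hzξ (hne w))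
        have hqarg : Complex.exp (q.arg * Complex.I) = q := by
          have := Complex.norm_mul_exp_arg_mul_I q
          rwa [hq1, Complex.ofReal_one, one_mul] at this
        refine ⟨-q.arg / (2 * l), ?_⟩
        set t := -q.arg / (2 * l) with ht
        have h3 := hN t z
        have h4 := hD t z
        have h5 : Complex.exp (-(l * t : ℝ) * Complex.I) =
            q * Complex.exp ((l * t : ℝ) * Complex.I) := by
          rw [← hqarg, ← Complex.exp_add]
          congr 1
          have : l * t = -q.arg / 2 := by rw [ht]; field_simp
          rw [this]
          push_cast
          ring
        have hDne := flowDen_ne_zero (h.sq_sub t) z.norm_lt_one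
        simp only
        have h6 : ((discFlow h t z : ℂ) - ξ) * (1 - conj ξ * w) =
            (w - ξ) * (1 - conj ξ * discFlow h t z) := by
          refine mul_right_cancel₀ (mul_ne_zero hDne (hne z)) ?_
          linear_combination (1 - conj ξ * w) * (1 - conj ξ * z) * h3
            - (w - ξ) * (1 - conj ξ * z) * h4
            + ((z : ℂ) - ξ) * (1 - conj ξ * w) * (1 - conj ξ * z) * h5
            + Complex.exp ((l * t : ℝ) * Complex.I) * (1 - conj ξ * z) * hqe
        have h7 : ((discFlow h t z : ℂ) - w) * (1 - (‖ξ‖ : ℂ) ^ 2) = 0 := by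
          rw [← conj_mul_self_eq]
          linear_combination h6
        refine sub_eq_zero.1 ((mul_eq_zero.1 h7).resolve_right ?_)
        have h8 : ‖ξ‖ ^ 2 < 1 := pow_lt_one₀ (norm_nonneg ξ) hξ two_ne_zero
        have h9 : (1 - ‖ξ‖ ^ 2 : ℝ) ≠ 0 := by linarith
        exact_mod_cast h9
  · refine ⟨_, hasDerivAt_discFlow h z t, ?_⟩
    have hMξ : (discFlow h t z : ℂ) - ξ ≠ 0 := by
      intro h0
      have h3 := hN t z
      rw [h0, zero_mul] at h3
      exact mul_ne_zero (Complex.exp_ne_zero _) (sub_ne_zero.2 hzξ) h3.symm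
    have hM := (discFlow h t z).norm_lt_one
    simp only
    generalize (discFlow h t z : ℂ) = x at hMξ hM ⊢
    rw [hfac]
    have h3 : conj (x - ξ) * (Complex.I * ((x - ξ) * (α * x - (ω + l)))) =
        ((‖x - ξ‖ ^ 2 : ℝ) : ℂ) * (Complex.I * (α * x - (ω + l))) := by
      push_cast
      rw [← conj_mul_self_eq]
      ring
    rw [h3, Complex.im_ofReal_mul]
    have h4 : (Complex.I * (α * x - (ω + l))).im = (α * x).re - (ω + l) := by
      simp [Complex.mul_im]
    rw [h4]
    have h5 : (α * x).re < ω := by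
      have := Complex.re_le_norm (α * x)
      rw [norm_mul] at this
      nlinarith [norm_nonneg α, norm_nonneg x]
    have h6 : 0 < ‖x - ξ‖ ^ 2 := by positivity
    exact mul_neg_of_pos_of_neg h6 (by linarith)

end Stable

/-! ### The free case -/

section Free

variable {ω : ℝ} {α : ℂ} {C S : ℝ → ℝ}

theorem norm_eq_one_of_conj_mul_self {ξ : ℂ} (hξ : conj ξ * ξ = 1) : ‖ξ‖ = 1 := by
  rw [conj_mul_self_eq] at hξ
  have h1 : ‖ξ‖ ^ 2 = 1 := by exact_mod_cast hξ
  exact (pow_eq_one_iff_of_nonneg (norm_nonneg _) two_ne_zero).1 h1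

theorem normSq_add_real (η : ℂ) (r : ℝ) : ‖η + r‖ ^ 2 = ‖η‖ ^ 2 + 2 * r * η.re + r ^ 2 := by
  rw [← Complex.normSq_eq_norm_sq, ← Complex.normSq_eq_norm_sq, Complex.normSq_apply,
    Complex.normSq_apply]
  simp
  ring

/-- In the coordinate `η = ξ̄ x - 1`, the horocycle of radius `r` is `|η|² = -2 r Re η`. -/
theorem mem_horocycle_iff {ξ : ℂ} (hξ : conj ξ * ξ = 1) {r : ℝ} (hr : 0 < r) (x : ℂ) :
    x ∈ horocycle ξ r ↔
      ‖conj ξ * x - 1‖ ^ 2 = -2 * r * (conj ξ * x - 1).re ∧ conj ξ * x - 1 ≠ 0 := by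
  have hξ1 : ‖conj ξ‖ = 1 := by rw [RCLike.norm_conj, norm_eq_one_of_conj_mul_self hξ]
  have h1 : ‖x - (1 - r) * ξ‖ = ‖(conj ξ * x - 1) + r‖ := by
    rw [← one_mul ‖x - (1 - r) * ξ‖, ← hξ1, ← norm_mul]
    congr 1
    linear_combination -(1 - r) * hξ
  have h2 : x = ξ ↔ conj ξ * x - 1 = 0 := by
    constructor
    · rintro rfl
      rw [hξ, sub_self]
    · intro h
      linear_combination ξ * h - x * hξ
  have h3 : ‖(conj ξ * x - 1) + r‖ = r ↔
      ‖conj ξ * x - 1‖ ^ 2 = -2 * r * (conj ξ * x - 1).re := by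
    rw [← sq_eq_sq₀ (norm_nonneg _) hr.le, normSq_add_real]
    constructor <;> intro h <;> linarith
  rw [horocycle, Set.mem_ofPred_eq, h1, h3, Ne, h2]

/-- In the coordinate `1 / η`, where `η = ξ̄ x - 1`, the flow is the translation by `-i ω t`, and
the horocycles are the vertical lines. -/
theorem free_case (hω : ω = ‖α‖) (hω0 : 0 < ω) (h : IsTrigPair (‖α‖ ^ 2 - ω ^ 2) C S) :
    xiMinus ω α = xiPlus ω α ∧ ‖xiPlus ω α‖ = 1 ∧ ∀ z : 𝔻, ∃ r : ℝ, 0 < r ∧ r < 1 ∧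
      orbit (discFlow h) z = horocycle (xiPlus ω α) r ∧
      Clockwise (fun t => (discFlow h t z : ℂ)) ((1 - r) * xiPlus ω α) := by
  have hα : α ≠ 0 := by
    rintro rfl
    rw [norm_zero] at hω
    exact hω0.ne' hω
  have hl : lam ω α = 0 := by
    rw [lam, if_pos hω.ge, hω, sub_self, Real.sqrt_zero, Complex.ofReal_zero]
  have hspec := xiPlus_spec hω0.le hα
  have heq : xiMinus ω α = xiPlus ω α := by rw [xiMinus, xiPlus, hl, sub_zero, add_zero]
  refine ⟨heq, ?_⟩
  rw [hl, neg_zero, sub_zero, add_zero] at hspec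
  generalize xiPlus ω α = ξ at hspec ⊢
  obtain ⟨h1, h2⟩ := hspec
  have hωc : (ω : ℂ) ≠ 0 := by exact_mod_cast hω0.ne'
  have hα' : α = ω * conj ξ := by
    have := congrArg conj h2
    simpa using this
  have hξ : conj ξ * ξ = 1 := by
    refine mul_left_cancel₀ hωc ?_
    rw [← mul_assoc, ← hα', h1, mul_one]
  have hξ1 := norm_eq_one_of_conj_mul_self hξ
  refine ⟨hξ1, fun z => ?_⟩
  have hC : ∀ t, C t = 1 := by
    intro t
    have h3 := is_const_of_deriv_eq_zero (fun t => (h.C_deriv t).differentiableAt)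
      (fun t => (h.C_deriv t).deriv.trans (by rw [← hω, sub_self, zero_mul])) t 0
    rw [h3, h.C_zero]
  have hS : ∀ t, S t = t := by
    intro t
    have h3 : ∀ t, HasDerivAt (fun t => S t - t) 0 t := fun t =>
      ((h.S_deriv t).sub (hasDerivAt_id t)).congr_deriv (by rw [hC, sub_self])
    have h4 := is_const_of_deriv_eq_zero (fun t => (h3 t).differentiableAt)
      (fun t => (h3 t).deriv) t 0
    rw [h.S_zero, sub_zero] at h4
    exact sub_eq_zero.1 h4
  -- the coordinate `η = ξ̄ x - 1`, in which the flow is `1/η ↦ 1/η - i ω t`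
  have hη : ∀ x : 𝔻, conj ξ * (x : ℂ) - 1 ≠ 0 := by
    intro x h0
    have h3 : ‖conj ξ * (x : ℂ)‖ < 1 := by
      rw [norm_mul, RCLike.norm_conj, hξ1, one_mul]
      exact x.norm_lt_one
    rw [sub_eq_zero.1 h0, norm_one] at h3
    exact lt_irrefl _ h3
  have hre : ∀ x : 𝔻, ‖conj ξ * (x : ℂ) - 1‖ ^ 2 < -2 * (conj ξ * (x : ℂ) - 1).re := by
    intro x
    have h3 := normSq_add_real (conj ξ * (x : ℂ) - 1) 1
    rw [Complex.ofReal_one, sub_add_cancel, norm_mul, RCLike.norm_conj, hξ1, one_mul] at h3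
    have h4 := x.sq_norm_lt_one
    linarith
  have hflow : ∀ t, (conj ξ * (discFlow h t z : ℂ) - 1) *
      (1 - Complex.I * ω * t * (conj ξ * (z : ℂ) - 1)) = conj ξ * z - 1 := by
    intro t
    have hD := flowDen_ne_zero (h.sq_sub t) z.norm_lt_one
    have h3 := flowNum_sub (l := 0) (by rw [sub_zero]; exact h1) (by rw [add_zero]; exact h2)
      (C t) (S t) (z : ℂ)
    have h4 : flowDen ω α (C t) (S t) z = 1 - Complex.I * ω * t * (conj ξ * (z : ℂ) - 1) := by
      rw [flowDen_eq, hC, hS, hα']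
      push_cast
      ring
    rw [← h4]
    have h5 : (discFlow h t z : ℂ) * flowDen ω α (C t) (S t) z = flowNum ω α (C t) (S t) z := by
      rw [coe_discFlow, div_mul_cancel₀ _ hD]
    rw [hC, mul_zero, zero_mul, sub_zero] at h3
    rw [hC] at h5 ⊢
    push_cast at h3
    linear_combination conj ξ * h5 + conj ξ * h3 + (flowDen ω α 1 (S t) z - 1) * hξ
  have hinv : ∀ t, (conj ξ * (discFlow h t z : ℂ) - 1)⁻¹ =
      (conj ξ * (z : ℂ) - 1)⁻¹ - Complex.I * ω * t := by
    intro t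
    have h3 := hη (discFlow h t z)
    have h4 := hη z
    have h5 := hflow t
    field_simp
    linear_combination -h5
  have hre_inv : ∀ (η : ℂ) (r : ℝ), 0 < r → η ≠ 0 →
      (‖η‖ ^ 2 = -2 * r * η.re ↔ η⁻¹.re = -1 / (2 * r)) := by
    intro η r hr h0
    have h3 : 0 < Complex.normSq η := Complex.normSq_pos.2 h0
    rw [Complex.inv_re, ← Complex.normSq_eq_norm_sq, div_eq_div_iff h3.ne' (by positivity)]
    constructor <;> intro h <;> linarith
  have hzre : (conj ξ * (z : ℂ) - 1).re < 0 := by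
    have := hre z
    nlinarith [sq_nonneg ‖conj ξ * (z : ℂ) - 1‖]
  have hnorm : 0 < ‖conj ξ * (z : ℂ) - 1‖ ^ 2 := by
    have := norm_pos_iff.2 (hη z)
    positivity
  obtain ⟨r, hr, hr1, hrz⟩ : ∃ r : ℝ, 0 < r ∧ r < 1 ∧
      ‖conj ξ * (z : ℂ) - 1‖ ^ 2 = -2 * r * (conj ξ * (z : ℂ) - 1).re := by
    refine ⟨‖conj ξ * (z : ℂ) - 1‖ ^ 2 / (-2 * (conj ξ * (z : ℂ) - 1).re),
      div_pos hnorm (by linarith), (div_lt_one (by linarith)).2 (hre z), ?_⟩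
    have := hzre.ne
    field_simp
  have hrt : ∀ t, ‖conj ξ * (discFlow h t z : ℂ) - 1‖ ^ 2 =
      -2 * r * (conj ξ * (discFlow h t z : ℂ) - 1).re := by
    intro t
    rw [hre_inv _ r hr (hη _), hinv, ← (hre_inv _ r hr (hη z)).1 hrz]
    simp
  refine ⟨r, hr, hr1, ?_, fun t => ⟨_, hasDerivAt_discFlow h z t, ?_⟩⟩
  · ext w
    rw [mem_horocycle_iff hξ hr]
    constructor
    · rintro ⟨t, rfl⟩
      exact ⟨hrt t, hη _⟩
    · rintro ⟨hw, hw0⟩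
      rw [hre_inv _ r hr hw0, ← (hre_inv _ r hr (hη z)).1 hrz] at hw
      refine ⟨((conj ξ * (z : ℂ) - 1)⁻¹.im - (conj ξ * w - 1)⁻¹.im) / ω, ?_⟩
      have h3 := hinv (((conj ξ * (z : ℂ) - 1)⁻¹.im - (conj ξ * w - 1)⁻¹.im) / ω)
      simp only
      generalize discFlow h (((conj ξ * (z : ℂ) - 1)⁻¹.im - (conj ξ * w - 1)⁻¹.im) / ω) z = y at h3
      have h4 : (conj ξ * (y : ℂ) - 1)⁻¹ = (conj ξ * w - 1)⁻¹ := by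
        rw [h3]
        apply Complex.ext
        · simp [hw]
        · simp [Complex.mul_im]
          field_simp
          ring
      have h5 := inv_injective h4
      linear_combination ξ * h5 + (w - y) * hξ
  · have h3 := hrt t
    have h4 := hη (discFlow h t z)
    simp only
    generalize (discFlow h t z : ℂ) = x at h3 h4 ⊢
    have h5 : α * x ^ 2 - 2 * ω * x + conj α = ω * ξ * (conj ξ * x - 1) ^ 2 := by
      rw [h2, hα']
      linear_combination (-ω * conj ξ * x ^ 2 + 2 * ω * x) * hξ
    have h6 : x - (1 - r) * ξ = ξ * ((conj ξ * x - 1) + r) := by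
      linear_combination -x * hξ
    rw [h5, h6]
    generalize conj ξ * x - 1 = η at h3 h4 ⊢
    have h7 : conj (ξ * (η + r)) * (Complex.I * (ω * ξ * η ^ 2)) =
        (ω : ℝ) * (Complex.I * ((conj η + r) * η ^ 2)) := by
      simp only [map_mul, map_add, Complex.conj_ofReal]
      linear_combination (conj η + r) * Complex.I * ω * η ^ 2 * hξ
    rw [h7, Complex.im_ofReal_mul]
    have h8 : (Complex.I * ((conj η + r) * η ^ 2)).im = -r * ‖η‖ ^ 2 := by
      rw [← Complex.normSq_eq_norm_sq, Complex.normSq_apply] at h3 ⊢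
      simp [Complex.mul_im, Complex.mul_re, pow_two]
      linear_combination η.re * h3
    rw [h8]
    have h9 := norm_pos_iff.2 h4
    have : 0 < ω * (r * ‖η‖ ^ 2) := by positivity
    linarith

end Free

/-! ### The unstable case -/

section Unstable

variable {ω : ℝ} {α : ℂ} {C S : ℝ → ℝ}

/-- The points `x` for which `k (x - p) / (x - q)` is real, together with `q`, form a circle or a
line through `p` and `q`. -/
theorem isGeneralizedCircle_of_im_eq_zero {p q k : ℂ} (hpq : p ≠ q) (hk : k ≠ 0) :
    IsGeneralizedCircle {x | (k * ((x - p) * conj (x - q))).im = 0} := by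
  have hd : p - q ≠ 0 := sub_ne_zero.2 hpq
  have hdn : 0 < Complex.normSq (p - q) := Complex.normSq_pos.2 hd
  rcases eq_or_ne k.im 0 with him | him
  · right
    have hre : k.re ≠ 0 := fun h => hk (Complex.ext h him)
    refine ⟨p, p - q, hd, ?_⟩
    have h1 : ∀ x : ℂ, (k * ((x - p) * conj (x - q))).im =
        k.re * ((x - p) * conj (p - q)).im := by
      intro x
      simp [Complex.mul_im, Complex.mul_re, him]
      left
      ring
    ext x
    rw [Set.mem_ofPred_eq, h1, mul_eq_zero, or_iff_right hre]
    constructor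
    · intro hx
      refine ⟨((x - p) * conj (p - q)).re / Complex.normSq (p - q), ?_⟩
      have h2 : ((((x - p) * conj (p - q)).re : ℝ) : ℂ) = (x - p) * conj (p - q) :=
        Complex.ext rfl hx.symm
      have h3 : (Complex.normSq (p - q) : ℂ) = (p - q) * conj (p - q) :=
        (Complex.mul_conj _).symm
      have h4 : conj (p - q) ≠ 0 := (map_ne_zero _).2 hd
      simp only
      rw [Complex.ofReal_div, h2, h3, mul_div_mul_right _ _ h4, div_mul_cancel₀ _ hd]
      ring
    · rintro ⟨t, rfl⟩
      rw [add_sub_cancel_left, mul_assoc, Complex.mul_conj, ← Complex.ofReal_mul,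
        Complex.ofReal_im]
  · left
    -- the center is found by completing the square in `Im k |y|² + Im (k (p - q)‾ y)`, `y = x - p`
    set c : ℂ := -Complex.I * conj k * (p - q) / (2 * k.im) with hc
    have h2k : (2 * k.im : ℂ) ≠ 0 := by
      refine mul_ne_zero two_ne_zero ?_
      exact_mod_cast him
    have hc0 : c ≠ 0 := div_ne_zero (mul_ne_zero (mul_ne_zero (neg_ne_zero.2 Complex.I_ne_zero)
      ((map_ne_zero _).2 hk)) hd) h2k
    refine ⟨p + c, ‖c‖, norm_pos_iff.2 hc0, ?_⟩
    have hc' : c * (2 * k.im) = -Complex.I * conj k * (p - q) := div_mul_cancel₀ _ h2k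
    ext x
    have h1 : (k * ((x - p) * conj (x - q))).im =
        k.im * (‖x - (p + c)‖ ^ 2 - ‖c‖ ^ 2) := by
      have hr := congrArg Complex.re hc'
      have hi := congrArg Complex.im hc'
      rw [← Complex.normSq_eq_norm_sq, ← Complex.normSq_eq_norm_sq, Complex.normSq_apply,
        Complex.normSq_apply]
      simp [Complex.mul_im, Complex.mul_re] at hr hi ⊢
      linear_combination (x.re - p.re) * hr + (x.im - p.im) * hi
    rw [Set.mem_ofPred_eq, h1, mul_eq_zero, or_iff_right him, mem_sphere_iff_norm, sub_eq_zero,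
      sq_eq_sq₀ (norm_nonneg _) (norm_nonneg _)]

/-- In the coordinate `(x - ξ₊) / (x - ξ₋)` the flow is the dilation by `exp (-2 μ t)`, the disk is
a half plane bounded by a line through the origin, and the orbits are open rays. -/
theorem unstable_case (h0 : 0 ≤ ω) (hω : ω < ‖α‖) (h : IsTrigPair (‖α‖ ^ 2 - ω ^ 2) C S) :
    ‖xiMinus ω α‖ = 1 ∧ ‖xiPlus ω α‖ = 1 ∧ ∀ z : 𝔻,
      IsHypercycle (orbit (discFlow h) z) (xiMinus ω α) (xiPlus ω α) ∧
      (Function.Injective fun t => discFlow h t z) ∧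
      Tendsto (fun t => (discFlow h t z : ℂ)) atBot (𝓝 (xiMinus ω α)) ∧
      Tendsto (fun t => (discFlow h t z : ℂ)) atTop (𝓝 (xiPlus ω α)) := by
  have hα : α ≠ 0 := by
    rintro rfl
    rw [norm_zero] at hω
    exact hω.not_ge h0
  have hpos : 0 < ‖α‖ ^ 2 - ω ^ 2 := by nlinarith [norm_nonneg α]
  obtain ⟨m, hl, hm0, hm2⟩ : ∃ m : ℝ, lam ω α = Complex.I * m ∧ 0 < m ∧ m ^ 2 = ‖α‖ ^ 2 - ω ^ 2 :=
    ⟨√(‖α‖ ^ 2 - ω ^ 2), by rw [lam, if_neg hω.not_ge], Real.sqrt_pos.2 hpos,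
      Real.sq_sqrt hpos.le⟩
  have hq := xiMinus_spec h0 hα
  have hp := xiPlus_spec h0 hα
  rw [hl] at hp hq
  generalize xiMinus ω α = q at hq ⊢
  generalize xiPlus ω α = p at hp ⊢
  obtain ⟨hq1, hq2⟩ := hq
  obtain ⟨hp1, hp2⟩ := hp
  have hnorm : ∀ x : ℂ, ∀ y : ℝ, y ^ 2 = m ^ 2 → α * x = ω + y * Complex.I → ‖x‖ = 1 := by
    intro x y hy hx
    have h3 := congrArg Complex.normSq hx
    rw [Complex.normSq_mul, Complex.normSq_add_mul_I, hy, hm2, Complex.normSq_eq_norm_sq,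
      Complex.normSq_eq_norm_sq, add_sub_cancel] at h3
    have h4 : ‖α‖ ^ 2 ≠ 0 := by positivity
    have h5 : ‖x‖ ^ 2 = 1 := mul_left_cancel₀ h4 (by rw [h3, mul_one])
    exact (pow_eq_one_iff_of_nonneg (norm_nonneg _) two_ne_zero).1 h5
  have hqn : ‖q‖ = 1 := hnorm q (-m) (by ring) (by rw [hq1]; push_cast; ring)
  have hpn : ‖p‖ = 1 := hnorm p m rfl (by rw [hp1]; ring)
  have hqq : conj q * q = 1 := by rw [conj_mul_self_eq, hqn]; simp
  have hmc : (m : ℂ) ≠ 0 := by exact_mod_cast hm0.ne'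
  have hpq : q ≠ p := by
    rintro rfl
    have h3 : 2 * Complex.I * (m : ℂ) = 0 := by linear_combination hq1 - hp1
    exact mul_ne_zero (mul_ne_zero two_ne_zero Complex.I_ne_zero) hmc h3
  refine ⟨hqn, hpn, fun z => ?_⟩
  have hne : ∀ (x : 𝔻) (y : ℂ), ‖y‖ = 1 → (x : ℂ) - y ≠ 0 := by
    intro x y hy h3
    have := x.norm_lt_one
    rw [sub_eq_zero.1 h3, hy] at this
    exact lt_irrefl _ this
  have hzp := hne z p hpn
  have hzq := hne z q hqn
  -- the unit circle in the coordinates adapted to the fixed points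
  have him : ∀ x : ℂ, (((ω : ℂ) - Complex.I * m) * ((x - p) * conj (x - q))).im =
      m * (1 - ‖x‖ ^ 2) := by
    intro x
    have h3 : ((ω : ℂ) - Complex.I * m) * p = (ω + Complex.I * m) * q := by
      refine mul_left_cancel₀ hα ?_
      linear_combination (ω - Complex.I * m) * hp1 - (ω + Complex.I * m) * hq1
    have h4 : ((ω : ℂ) - Complex.I * m) * ((x - p) * conj (x - q)) =
        (ω - Complex.I * m) * (‖x‖ ^ 2 : ℝ) - ((ω - Complex.I * m) * conj q * x +
          conj ((ω - Complex.I * m) * conj q * x)) + (ω + Complex.I * m) := by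
      push_cast
      rw [← conj_mul_self_eq]
      simp only [map_mul, map_sub, Complex.conj_ofReal, Complex.conj_I, Complex.conj_conj]
      linear_combination (conj q - conj x) * h3 + (ω + Complex.I * m) * hqq
    rw [h4, Complex.add_conj]
    simp [Complex.mul_im, Complex.mul_re, -Complex.ofReal_pow]
    ring
  -- in the coordinate `(x - p) / (x - q)` the flow is multiplication by `exp (-2 m t)`
  have hN : ∀ (t : ℝ) {ξ l : ℂ}, α * ξ = ω - l → conj α = (ω + l) * ξ → l ^ 2 = -m ^ 2 →
      ((discFlow h t z : ℂ) - ξ) * flowDen ω α (C t) (S t) z =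
        Complex.exp (-Complex.I * l * t) * (z - ξ) := by
    intro t ξ l h1 h2 h3
    rw [← h.sub_eq_exp (l := l) (by rw [h3, ← hm2]; push_cast; ring), ← flowNum_sub h1 h2,
      coe_discFlow, sub_mul, div_mul_cancel₀ _ (flowDen_ne_zero (h.sq_sub t) z.norm_lt_one)]
  have hflow : ∀ t : ℝ, ((discFlow h t z : ℂ) - p) * (z - q) =
      (Real.exp (-(2 * m * t)) : ℂ) * ((z - p) * (discFlow h t z - q)) := by
    intro t
    have hD := flowDen_ne_zero (h.sq_sub t) z.norm_lt_one
    have h3 := hN t hp1 hp2 (by linear_combination (m : ℂ) ^ 2 * Complex.I_sq)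
    have h4 := hN t hq1 hq2 (by linear_combination (m : ℂ) ^ 2 * Complex.I_sq)
    have h5 : Complex.exp (-Complex.I * -(Complex.I * m) * t) =
        (Real.exp (-(2 * m * t)) : ℂ) * Complex.exp (-Complex.I * (Complex.I * m) * t) := by
      rw [Complex.ofReal_exp, ← Complex.exp_add]
      congr 1
      push_cast
      linear_combination 2 * m * t * Complex.I_sq
    rw [h5] at h3
    refine mul_right_cancel₀ hD ?_
    linear_combination (z - q) * h3 - (Real.exp (-(2 * m * t)) : ℂ) * (z - p) * h4
  have hnorm2 : ∀ (t : ℝ) (ξ : ℂ), ‖ξ‖ = 1 → ‖(discFlow h t z : ℂ) - ξ‖ ≤ 2 := by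
    intro t ξ hξ
    refine (norm_sub_le _ _).trans ?_
    have := (discFlow h t z).norm_lt_one
    rw [hξ]
    linarith
  have hflown : ∀ t : ℝ, ‖(discFlow h t z : ℂ) - p‖ * ‖(z : ℂ) - q‖ =
      Real.exp (-(2 * m * t)) * (‖(z : ℂ) - p‖ * ‖(discFlow h t z : ℂ) - q‖) := by
    intro t
    have h3 := congrArg norm (hflow t)
    rwa [norm_mul, norm_mul, norm_mul, Complex.norm_real,
      Real.norm_of_nonneg (Real.exp_pos _).le] at h3
  have hzpn := norm_pos_iff.2 hzp
  have hzqn := norm_pos_iff.2 hzq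
  refine ⟨⟨hpq, {x | (conj ((z : ℂ) - p) * (z - q) * ((x - p) * conj (x - q))).im = 0},
    isGeneralizedCircle_of_im_eq_zero hpq.symm (mul_ne_zero ((map_ne_zero _).2 hzp) hzq),
    ?_, ?_⟩, ?_, ?_, ?_⟩
  · -- on the unit circle, `(x - p) (x - q)‾` is real in one frame and would have to be real
    -- in a different frame
    ext x
    constructor
    · rintro ⟨hx, hx1⟩
      rw [Set.mem_ofPred_eq] at hx hx1
      have h3 := him x
      rw [hx1] at h3
      have h4 := him z
      have hz2 := z.sq_norm_lt_one
      have h5 : (x - p) * conj (x - q) = 0 := by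
        by_contra hG
        have h6 := Complex.normSq_pos.2 hG
        have h7 : conj ((z : ℂ) - p) * (z - q) = conj ((z - p) * conj ((z : ℂ) - q)) := by
          simp
        rw [h7] at hx
        generalize (x - p) * conj (x - q) = G at *
        generalize ((z : ℂ) - p) * conj ((z : ℂ) - q) = Z at *
        have h8 : 0 < m * (1 - ‖(z : ℂ)‖ ^ 2) := mul_pos hm0 (by linarith)
        rw [← h4] at h8
        rw [Complex.normSq_apply] at h6
        simp [Complex.mul_im] at hx h3 h8
        have h9 : (ω * Z.im - m * Z.re) * (G.re * G.re + G.im * G.im) = 0 := by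
          linear_combination (Z.re * G.re + Z.im * G.im) * h3 - (ω * G.re + m * G.im) * hx
        rcases mul_eq_zero.1 h9 with h9 | h9 <;> linarith
      rcases mul_eq_zero.1 h5 with h6 | h6
      · exact .inr (sub_eq_zero.1 h6)
      · exact .inl (sub_eq_zero.1 ((map_eq_zero _).1 h6))
    · rintro (rfl | rfl)
      · exact ⟨by simp, hqn⟩
      · exact ⟨by simp, hpn⟩
  · ext x
    constructor
    · rintro ⟨t, rfl⟩
      refine ⟨?_, (discFlow h t z).norm_lt_one⟩
      rw [Set.mem_ofPred_eq]
      have h3 : conj ((z : ℂ) - p) * (z - q) *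
          (((discFlow h t z : ℂ) - p) * conj ((discFlow h t z : ℂ) - q)) =
          ((Real.exp (-(2 * m * t)) *
            (‖(z : ℂ) - p‖ ^ 2 * ‖(discFlow h t z : ℂ) - q‖ ^ 2) : ℝ) : ℂ) := by
        push_cast [← conj_mul_self_eq]
        have := hflow t
        push_cast at this
        linear_combination conj ((z : ℂ) - p) * conj ((discFlow h t z : ℂ) - q) * this
      simp only
      rw [h3, Complex.ofReal_im]
    · rintro ⟨hx, hx1⟩
      obtain ⟨x, rfl⟩ : ∃ x' : 𝔻, (x' : ℂ) = x := ⟨.mk x hx1, rfl⟩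
      rw [Set.mem_ofPred_eq] at hx
      have hxp := hne x p hpn
      have hxq := hne x q hqn
      -- the sign of the real quotient of the two coordinates is positive, because the disk is
      -- a half plane in this coordinate
      obtain ⟨s, hs, hs'⟩ : ∃ s : ℝ, 0 < s ∧
          conj ((z : ℂ) - p) * (z - q) * ((x - p) * conj ((x : ℂ) - q)) = s := by
        refine ⟨(conj ((z : ℂ) - p) * (z - q) * ((x - p) * conj ((x : ℂ) - q))).re, ?_,
          Complex.ext rfl (by rw [hx, Complex.ofReal_im])⟩
        have h3 := him x
        have h4 := him z
        have hz2 := z.sq_norm_lt_one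
        have hx2 := x.sq_norm_lt_one
        have h7 : conj ((z : ℂ) - p) * (z - q) = conj ((z - p) * conj ((z : ℂ) - q)) := by
          simp
        have h6 := Complex.normSq_pos.2 (mul_ne_zero hxp ((map_ne_zero conj).2 hxq))
        rw [h7] at hx ⊢
        generalize ((x : ℂ) - p) * conj ((x : ℂ) - q) = G at *
        generalize ((z : ℂ) - p) * conj ((z : ℂ) - q) = Z at *
        have h8 : 0 < m * (1 - ‖(z : ℂ)‖ ^ 2) := mul_pos hm0 (by linarith)
        have h9 : 0 < m * (1 - ‖(x : ℂ)‖ ^ 2) := mul_pos hm0 (by linarith)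
        rw [← h4] at h8
        rw [← h3] at h9
        rw [Complex.normSq_apply] at h6
        simp [Complex.mul_im, Complex.mul_re] at hx h8 h9 ⊢
        have h10 : (ω * Z.im - m * Z.re) * (G.re * G.re + G.im * G.im) =
            (Z.re * G.re + Z.im * G.im) * (ω * G.im - m * G.re) := by
          linear_combination -(ω * G.re + m * G.im) * hx
        have h11 : 0 < (ω * Z.im - m * Z.re) * (G.re * G.re + G.im * G.im) :=
          mul_pos (by linarith) h6
        rw [h10] at h11
        have h12 := (pos_iff_pos_of_mul_pos h11).2 (by linarith)
        linarith
      have hxqn := norm_pos_iff.2 hxq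
      have hE : 0 < s / (‖(x : ℂ) - q‖ ^ 2 * ‖(z : ℂ) - p‖ ^ 2) := by positivity
      refine ⟨-Real.log (s / (‖(x : ℂ) - q‖ ^ 2 * ‖(z : ℂ) - p‖ ^ 2)) / (2 * m), ?_⟩
      have h3 := hflow (-Real.log (s / (‖(x : ℂ) - q‖ ^ 2 * ‖(z : ℂ) - p‖ ^ 2)) / (2 * m))
      rw [mul_div_cancel₀ _ (by positivity), neg_neg, Real.exp_log hE] at h3
      simp only
      generalize (discFlow h (-Real.log (s / (‖(x : ℂ) - q‖ ^ 2 * ‖(z : ℂ) - p‖ ^ 2)) /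
        (2 * m)) z : ℂ) = y at h3 ⊢
      have h4 : ((s / (‖(x : ℂ) - q‖ ^ 2 * ‖(z : ℂ) - p‖ ^ 2) : ℝ) : ℂ) * ((z - p) * (x - q)) =
          (x - p) * (z - q) := by
        push_cast [← conj_mul_self_eq]
        rw [← hs']
        have h5 : conj ((x : ℂ) - q) ≠ 0 := (map_ne_zero _).2 hxq
        have h6 : conj ((z : ℂ) - p) ≠ 0 := (map_ne_zero _).2 hzp
        field_simp
      have h5 : (y - x) * ((q - p) * ((z : ℂ) - q)) = 0 := by
        linear_combination -(x - q) * h3 - (y - q) * h4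
      refine sub_eq_zero.1 ((mul_eq_zero.1 h5).resolve_right
        (mul_ne_zero (sub_ne_zero.2 hpq) hzq))
  · intro t t' htt'
    have h3 := hflow t
    have h4 := hflow t'
    simp only at htt'
    rw [← htt', h3] at h4
    have h5 := mul_right_cancel₀ (mul_ne_zero hzp (hne _ q hqn)) h4
    have h6 : Real.exp (-(2 * m * t)) = Real.exp (-(2 * m * t')) := by exact_mod_cast h5
    have h7 := Real.exp_injective h6
    have h8 : 2 * m ≠ 0 := by positivity
    exact mul_left_cancel₀ h8 (neg_injective h7)
  · rw [tendsto_iff_norm_sub_tendsto_zero]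
    have h3 : Tendsto (fun t : ℝ => Real.exp (2 * m * t) * (2 * ‖(z : ℂ) - q‖ / ‖(z : ℂ) - p‖))
        atBot (𝓝 0) := by
      rw [← zero_mul (2 * ‖(z : ℂ) - q‖ / ‖(z : ℂ) - p‖)]
      exact (Real.tendsto_exp_atBot.comp (tendsto_id.const_mul_atBot (by positivity))).mul_const _
    refine squeeze_zero (fun t => norm_nonneg _) (fun t => ?_) h3
    have h4 := hflown t
    have h5 : Real.exp (2 * m * t) * Real.exp (-(2 * m * t)) = 1 := by
      rw [← Real.exp_add, add_neg_cancel, Real.exp_zero]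
    have h6 : ‖(z : ℂ) - p‖ * ‖(discFlow h t z : ℂ) - q‖ =
        Real.exp (2 * m * t) * (‖(discFlow h t z : ℂ) - p‖ * ‖(z : ℂ) - q‖) := by
      rw [h4, ← mul_assoc, h5, one_mul]
    rw [mul_div_assoc', le_div_iff₀ hzpn, mul_comm, h6]
    have := hnorm2 t p hpn
    gcongr
  · rw [tendsto_iff_norm_sub_tendsto_zero]
    have h3 : Tendsto (fun t : ℝ => Real.exp (-(2 * m * t)) *
        (‖(z : ℂ) - p‖ * 2 / ‖(z : ℂ) - q‖)) atTop (𝓝 0) := by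
      rw [← zero_mul (‖(z : ℂ) - p‖ * 2 / ‖(z : ℂ) - q‖)]
      exact (Real.tendsto_exp_neg_atTop_nhds_zero.comp
        (tendsto_id.const_mul_atTop (by positivity))).mul_const _
    refine squeeze_zero (fun t => norm_nonneg _) (fun t => ?_) h3
    rw [mul_div_assoc', le_div_iff₀ hzqn, hflown t]
    have := hnorm2 t q hqn
    gcongr

end Unstable

end Squeezed

theorem theorem1 {H : Type*} [NormedAddCommGroup H] [InnerProductSpace ℂ H] [CompleteSpace H]
    [Nontrivial H] (a : H →ₗ.[ℂ] H) (ha : Squeezed.IsIrreducibleCCR a)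
    (ω : ℝ) (hω : 0 ≤ ω) (α : ℂ) :
    -- `z ↦ [ψ(z)]` is a bijection from the open unit disk to the squeezed states
    (∀ z : ℂ, ‖z‖ < 1 → Module.finrank ℂ (Squeezed.squeezedLine a z) = 1) ∧
    (∀ z : ℂ, 1 ≤ ‖z‖ → Squeezed.squeezedLine a z = ⊥) ∧
    (Function.Injective fun z : 𝔻 => Squeezed.squeezedLine a (z : ℂ)) ∧
    -- the evolution exists, is unique, and acts on the disk
    ∃ U : ℝ → H →L[ℂ] H, Squeezed.IsEvolution (Squeezed.hamiltonian a ω α) U ∧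
      (∀ V : ℝ → H →L[ℂ] H, Squeezed.IsEvolution (Squeezed.hamiltonian a ω α) V → V = U) ∧
      ∃ M : ℝ → 𝔻 → 𝔻,
        (∀ (t : ℝ) (z : 𝔻), (Squeezed.squeezedLine a (z : ℂ)).map (U t : H →ₗ[ℂ] H) =
          Squeezed.squeezedLine a (M t z : ℂ)) ∧
        Squeezed.IsMobiusFlow M ∧
        -- the stable case
        (‖α‖ < ω → ‖Squeezed.xiMinus ω α‖ < 1 ∧ ∀ z : 𝔻,
          Squeezed.orbit M z = Squeezed.hypCircle (Squeezed.xiMinus ω α)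
            (Squeezed.hdist (Squeezed.xiMinus ω α) z) ∧
          ((z : ℂ) ≠ Squeezed.xiMinus ω α →
            Squeezed.Clockwise (fun t => (M t z : ℂ)) (Squeezed.xiMinus ω α))) ∧
        -- the free case
        (ω = ‖α‖ → 0 < ω →
          Squeezed.xiMinus ω α = Squeezed.xiPlus ω α ∧ ‖Squeezed.xiPlus ω α‖ = 1 ∧
          ∀ z : 𝔻, ∃ r : ℝ, 0 < r ∧ r < 1 ∧
            Squeezed.orbit M z = Squeezed.horocycle (Squeezed.xiPlus ω α) r ∧
            Squeezed.Clockwise (fun t => (M t z : ℂ)) ((1 - r) * Squeezed.xiPlus ω α)) ∧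
        -- the unstable case
        (ω < ‖α‖ →
          ‖Squeezed.xiMinus ω α‖ = 1 ∧ ‖Squeezed.xiPlus ω α‖ = 1 ∧
          ∀ z : 𝔻,
            Squeezed.IsHypercycle (Squeezed.orbit M z)
              (Squeezed.xiMinus ω α) (Squeezed.xiPlus ω α) ∧
            (Function.Injective fun t => M t z) ∧
            Tendsto (fun t => (M t z : ℂ)) atBot (𝓝 (Squeezed.xiMinus ω α)) ∧
            Tendsto (fun t => (M t z : ℂ)) atTop (𝓝 (Squeezed.xiPlus ω α))) := by
  obtain ⟨b, hb⟩ := ha.exists_numberBasis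
  obtain ⟨C, S, hCS⟩ := Squeezed.exists_isTrigPair (‖α‖ ^ 2 - ω ^ 2)
  have hdense := hb.dense_solutionSpace (ω := ω) (α := α) ha.closed ha.dense fun z hz =>
    ⟨fun t => Squeezed.discFlow hCS t (.mk z hz), by simp [Squeezed.discFlow_zero],
      fun t => Complex.UnitDisc.norm_lt_one _, Squeezed.hasDerivAt_discFlow hCS _⟩
  obtain ⟨U, hU, hunique⟩ :=
    Squeezed.exists_isEvolution (Squeezed.isSymm_hamiltonian ha.dense) hdense
  refine ⟨fun z hz => ?_, fun z => hb.squeezedLine_eq_bot,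
    hb.squeezedLine_injective ha.closed ha.dense, U, hU, hunique, Squeezed.discFlow hCS,
    fun t z => ?_, Squeezed.isMobiusFlow_discFlow hCS, fun h => Squeezed.stable_case h hCS,
    fun h h0 => Squeezed.free_case h h0 hCS, fun h => Squeezed.unstable_case hω h hCS⟩
  · rw [hb.squeezedLine_eq_span ha.closed ha.dense hz]
    exact finrank_span_singleton (Squeezed.gaussVec_ne_zero b hz)
  · obtain ⟨c, hc0, hc, hs⟩ := hb.exists_isSolution (m := 0) ha.closed ha.dense (.inl rfl)
      (fun t => (Squeezed.discFlow hCS t z).norm_lt_one) (Squeezed.hasDerivAt_discFlow hCS z)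
    have h1 := hU.apply_eq hs t
    simp only [hc0, one_smul, Squeezed.discFlow_zero] at h1
    rw [hb.squeezedLine_eq_span ha.closed ha.dense z.norm_lt_one,
      hb.squeezedLine_eq_span ha.closed ha.dense (Squeezed.discFlow hCS t z).norm_lt_one,
      Submodule.map_span, Set.image_singleton, ContinuousLinearMap.coe_coe, h1]
    exact Submodule.span_singleton_smul_eq (hc t).isUnit _
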